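/- **Setting.** Let $N,d\ge 1$, $T>0$, $\mathcal X=\{1,\dots,d\}$, $\Sigma=\{\mu\in\{0,\tfrac1N,\dots,1\}^d:\sum_x\mu_x=1\}$, $\mathscr X=\mathcal X\times\Sigma$, $n^\mu_x=N\mu_x$, $e_{x,z}=\frac1N(e_x-e_z)$, and $\mathbb R_+=[0,\infty)$. Vectors $a\in\mathbb R^{d-1}$ attached to a position $x$ are indexed by the positions $y\ne x$, and $|\cdot|_2$ is the Euclidean norm. Given are rates $\lambda^0,\lambda^1:\mathscr X\to\mathbb R_+^{d-1}$ and costs $\ell:\mathscr X\times\mathbb R_+^{d-1}\to\mathbb R_+$, $g:\mathscr X\to\mathbb R_+$, where $\ell$ is continuous and, for some $\gamma>0$, all $(x,\mu)\in\mathscr X$, $a,a'\in\mathbb R_+^{d-1}$ and $\tau\in[0,1]$, $$\tau\ell(x,\mu,a')+(1-\tau)\ell(x,\mu,a)-\ell(x,\mu,\tau a'+(1-\tau)a)\ge\gamma\tau(1-\tau)|a'-a|_2^2 .$$ Let $\mathscr A$ be the set of Lipschitz functions $[0,T]\times\mathscr X\to\mathbb R_+^{d-1}$ (admissible feedback controls),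 and, for a constant $c_a$, let $\mathscr A^*\subset\mathscr A$ be the set of those $\beta$ with $|\beta(t,x,\mu)|_2\le c_a$ for all $(t,x,\mu)$. For $\alpha,\beta\in\mathscr A$ let $\Xi=(X,\mu)$ be the time-inhomogeneous Markov chain on $\mathscr X$ with generator $\mathscr L^\alpha_x+\mathscr L^\beta_\mu$, where $$\mathscr L^\alpha_x\varphi(t,x,\mu)=\sum_{y\ne x}\bigl(\lambda^0_y(x,\mu)+\lambda^1_y(x,\mu)\alpha_y(t,x,\mu)\bigr)\bigl[\varphi(y,\mu)-\varphi(x,\mu)\bigr],$$ $$\mathscr L^\beta_\mu\varphi(t,x,\mu)=\sum_{y\ne z}n^\mu_z\bigl(\lambda^0_y(z,\mu+e_{x,z})+\lambda^1_y(z,\mu+e_{x,z})\beta_y(t,z,\mu+e_{x,z})\bigr)\bigl[\varphi(x,\mu+e_{y,z})-\varphi(x,\mu)\bigr].$$ The value function of the tagged player against $\beta$ is $$v^\beta(t,x,\mu)=\inf_{\alpha\in\mathscr A}\mathbb E^{\alpha\otimes\beta}\Bigl[\int_t^T\ell(\Xi_u,\alpha(u,\Xi_u))\,du+g(\Xi_T)\,\Big|\,\Xi_t=(x,\mu)\Bigr].$$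 Put $\Delta_x\varphi=(\varphi(y)-\varphi(x))_{y\ne x}$, $H(x,\mu,p)=\inf_{a\in\mathbb R_+^{d-1}}\{\ell(x,\mu,a)+\sum_{y\ne x}(\lambda^0_y+\lambda^1_ya_y)(x,\mu)\,p_y\}$, and let $\hat\alpha(x,\mu,p)$ be the unique minimizer over $a\in\mathbb R_+^{d-1}$ of $\ell(x,\mu,a)+\sum_{y\ne x}a_y\lambda^1_y(x,\mu)p_y$. The best response to $\beta$ is $\alpha^*(\beta)(t,x,\mu)=\hat\alpha(x,\mu,\Delta_xv^\beta(t,\cdot,\mu))$, and $\alpha\in\mathscr A$ is a (symmetric) Markov perfect equilibrium if $\alpha=\alpha^*(\alpha)$. A classical solution of HJB$(\beta)$ is a function $v$ on $[0,T]\times\mathscr X$, differentiable in time, with $$-\tfrac{d}{dt}v(t,x,\mu)=H(x,\mu,\Delta_xv(t,\cdot,\mu))+\mathscr L^\beta_\mu v(t)(t,x,\mu),\qquad v(T,x,\mu)=g(x,\mu);$$ a classical solution of the $N$-NLL system is a $v$ that satisfies this with $\beta$ replaced by $\hat\alpha(x,\mu,\Delta_xv(t,\cdot,\mu))$. **Theorem.**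 The $N$-NLL system has a unique classical solution $v$, and $\alpha(t,x,\mu)=\hat\alpha(x,\mu,\Delta_xv(t,\cdot,\mu))$ is the unique Markov perfect equilibrium. Let $\rho\in[0,1)$, let $c_a$ be any constant and $\beta^{(0)}\in\mathscr A^*$, and define for $n\ge1$ the Picard iteration ($\rho=0$) or weighted Picard iteration ($\rho\in(0,1)$) $$v^{(n)}=v^{\beta^{(n-1)}},\qquad\alpha^{(n)}=\alpha^*(\beta^{(n-1)}),\qquad\beta^{(n)}=\rho\beta^{(n-1)}+(1-\rho)\alpha^{(n)}.$$ Then all $\beta^{(n)}$ are admissible, $v^{(n)}$ is the unique classical solution of HJB$(\beta^{(n-1)})$, and, as $n\to\infty$, $v^{(n)}\to v$ and $\alpha^{(n)}\to\alpha$ uniformly on $[0,T]\times\mathscr X$. -/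

import Mathlib

open Set Filter Topology

noncomputable section

namespace SymGame

/-- The discretized simplex of empirical distributions of `N` players over the `d = m + 1` states
`Fin (m + 1)`. The point `μ` is stored through its integer counts `n_x = N μ_x`, that is, `μ = n / N`. -/
abbrev Simplex (m N : ℕ) : Type := {n : Fin (m + 1) → ℕ // ∑ x, n x = N}

instance (m N : ℕ) : Fintype (Simplex m N) :=
  Fintype.subtype (Finset.piAntidiag Finset.univ N) (fun n => by simp)

/-- The state space: the position of the tagged player and the empirical distribution of the
`N` other players. -/
abbrev State (m N : ℕ) : Type := Fin (m + 1) × Simplex m N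

/-- The vectors in `ℝ^{d-1}`, with the Euclidean norm. Attached to a current position `x`, the
coordinate `i` belongs to the position `y = x.succAbove i ≠ x`: this is `y = i` below `x` and
`y = i + 1` from `x` on. -/
abbrev RateVec (m : ℕ) : Type := EuclideanSpace ℝ (Fin m)

/-- The nonnegative orthant `ℝ_+^{d-1}`. -/
def orthant (m : ℕ) : Set (RateVec m) := {a | ∀ i, 0 ≤ a i}

/-- Feedback controls; only their values at times in `[0,T]` matter. -/
abbrev Control (m N : ℕ) : Type := ℝ → State m N → RateVec m

/-- `move μ y z` is `μ + (e_y - e_z) / N`: one of the players located at `z` is put at `y`.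
If nobody is at `z`, then `μ` is returned; this value is only ever used with the factor `n_z = 0`. -/
def move {m N : ℕ} (μ : Simplex m N) (y z : Fin (m + 1)) : Simplex m N :=
  if h : 0 < μ.1 z then
    ⟨fun w => (if w = z then μ.1 w - 1 else μ.1 w) + (if w = y then 1 else 0), by
      have h1 : ∀ w, (if w = z then μ.1 w - 1 else μ.1 w) + (if w = z then 1 else 0) = μ.1 w := by
        intro w
        by_cases hw : w = z
        · subst hw; simp; omega
        · simp [hw]
      have h2 := μ.2
      rw [← Finset.sum_congr rfl (fun w _ => h1 w), Finset.sum_add_distrib] at h2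
      rw [Finset.sum_add_distrib]
      simpa using h2⟩
  else μ

/-- First difference vector `Δ_x φ(·, μ) = (φ(y, μ) - φ(x, μ))_{y ≠ x}` at `ξ = (x, μ)`. -/
def diffVec {m N : ℕ} (φ : State m N → ℝ) (ξ : State m N) : RateVec m :=
  WithLp.toLp 2 fun i => φ (ξ.1.succAbove i, ξ.2) - φ ξ

/-- The data of the symmetric game with `N + 1` players on `d = m + 1` states, with the standing
assumptions on them. The values of `cost` off the orthant play no role. -/
structure Game (m N : ℕ) where
  /-- time horizon -/
  T : ℝ
  T_pos : 0 < T
  /-- uncontrolled rates `λ⁰` -/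
  rate0 : State m N → RateVec m
  /-- coefficients `λ¹` of the controlled rates -/
  rate1 : State m N → RateVec m
  rate0_nonneg : ∀ ξ i, 0 ≤ rate0 ξ i
  rate1_nonneg : ∀ ξ i, 0 ≤ rate1 ξ i
  /-- running cost `ℓ(x, μ, a)` -/
  cost : State m N → RateVec m → ℝ
  /-- terminal cost `g(x, μ)` -/
  terminal : State m N → ℝ
  cost_nonneg : ∀ ξ, ∀ a ∈ orthant m, 0 ≤ cost ξ a
  terminal_nonneg : ∀ ξ, 0 ≤ terminal ξ
  cost_continuous : ∀ ξ, ContinuousOn (cost ξ) (orthant m)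
  /-- `ℓ(x, μ, ·)` is strongly convex, uniformly in `(x, μ)` -/
  cost_strongConvex : ∃ γ : ℝ, 0 < γ ∧ ∀ ξ, ∀ a ∈ orthant m, ∀ a' ∈ orthant m,
    ∀ τ ∈ Icc (0 : ℝ) 1,
      γ * τ * (1 - τ) * ‖a' - a‖ ^ 2 ≤
        τ * cost ξ a' + (1 - τ) * cost ξ a - cost ξ (τ • a' + (1 - τ) • a)

namespace Game

variable {m N : ℕ} (G : Game m N)

/-- Admissible controls: Lipschitz functions `[0,T] × State → ℝ_+^{d-1}`. As the state space is
finite, this is Lipschitz continuity in time, uniformly in the state. -/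
def Admissible (α : Control m N) : Prop :=
  (∀ t ∈ Icc 0 G.T, ∀ ξ, α t ξ ∈ orthant m) ∧
    ∃ K : NNReal, ∀ ξ, LipschitzOnWith K (fun t => α t ξ) (Icc 0 G.T)

/-- Admissible controls bounded by `c` in the Euclidean norm at all times and states. -/
def AdmissibleBdd (c : ℝ) (α : Control m N) : Prop :=
  G.Admissible α ∧ ∀ t ∈ Icc 0 G.T, ∀ ξ, ‖α t ξ‖ ≤ c

/-- Generator of the tagged player, acting on the position, when the vector `a ξ` is the control
in the state `ξ`. -/
def genX (a : State m N → RateVec m) (φ : State m N → ℝ) (ξ : State m N) : ℝ :=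
  ∑ i, (G.rate0 ξ i + G.rate1 ξ i * a ξ i) * (φ (ξ.1.succAbove i, ξ.2) - φ ξ)

/-- Generator of the other players, acting on the empirical distribution, when each of them uses
the control `b`. A player at `z` sees itself at `z` and the others distributed as
`μ + e_{x,z}`, and moves to `y = z.succAbove i`. -/
def genMu (b : State m N → RateVec m) (φ : State m N → ℝ) (ξ : State m N) : ℝ :=
  ∑ z, ∑ i, (ξ.2.1 z : ℝ) *
    (G.rate0 (z, move ξ.2 ξ.1 z) i + G.rate1 (z, move ξ.2 ξ.1 z) i * b (z, move ξ.2 ξ.1 z) i) *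
      (φ (ξ.1, move ξ.2 (z.succAbove i) z) - φ ξ)

/-- `p u η = ℙ^{α⊗β}(Ξ_u = η | Ξ_t = ξ)`, `u ∈ [t,T]`, for the time-inhomogeneous Markov chain
with generator `L^α_x + L^β_μ`: a flow of probability vectors that starts from the Dirac mass at
`ξ` and solves Kolmogorov's forward equation, tested with all functions on the finite state space.
For admissible `α`, `β` and `t ∈ [0,T]` such a flow exists and is unique on `[t,T]`. -/
def IsLaw (α β : Control m N) (t : ℝ) (ξ : State m N) (p : ℝ → State m N → ℝ) : Prop :=
  p t = Pi.single ξ 1 ∧ (∀ u ∈ Icc t G.T, p u ∈ stdSimplex ℝ (State m N)) ∧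
    ∀ φ : State m N → ℝ, ∀ u ∈ Icc t G.T,
      HasDerivWithinAt (fun s => ∑ η, p s η * φ η)
        (∑ η, p u η * (G.genX (α u) φ η + G.genMu (β u) φ η)) (Icc t G.T) u

/-- The transition probabilities `ℙ^{α⊗β}(Ξ_u = η | Ξ_t = ξ)`. -/
def law (α β : Control m N) (t : ℝ) (ξ : State m N) : ℝ → State m N → ℝ :=
  Classical.epsilon (G.IsLaw α β t ξ)

/-- The cost functional
`J(t, ξ, α; β) = 𝔼^{α⊗β}[∫_t^T ℓ(Ξ_u, α(u, Ξ_u)) du + g(Ξ_T) | Ξ_t = ξ]`. -/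
def J (t : ℝ) (ξ : State m N) (α β : Control m N) : ℝ :=
  (∫ u in t..G.T, ∑ η, G.law α β t ξ u η * G.cost η (α u η)) +
    ∑ η, G.law α β t ξ G.T η * G.terminal η

/-- The value function `v^β = inf_α J(·, ·, α; β)` of the tagged player. -/
def value (β : Control m N) (t : ℝ) (ξ : State m N) : ℝ :=
  ⨅ α : {α : Control m N // G.Admissible α}, G.J t ξ α.1 β

/-- The Hamiltonian `H(x, μ, p)`. -/
def H (ξ : State m N) (p : RateVec m) : ℝ :=
  ⨅ a : orthant m, (G.cost ξ a.1 + ∑ i, (G.rate0 ξ i + G.rate1 ξ i * a.1 i) * p i)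

/-- The function of `a` minimized by `α̂(x, μ, p)`. -/
def preHam (ξ : State m N) (p : RateVec m) (a : RateVec m) : ℝ :=
  G.cost ξ a + ∑ i, a i * G.rate1 ξ i * p i

theorem exists_argmin (ξ : State m N) (p : RateVec m) :
    ∃! a, a ∈ orthant m ∧ IsMinOn (G.preHam ξ p) (orthant m) a := by
  obtain ⟨γ, hγ, hconv⟩ := G.cost_strongConvex
  have hc : ∀ a ∈ orthant m, ∀ a' ∈ orthant m, ∀ τ ∈ Icc (0 : ℝ) 1,
      γ * τ * (1 - τ) * ‖a' - a‖ ^ 2 ≤ τ * G.preHam ξ p a' + (1 - τ) * G.preHam ξ p a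
        - G.preHam ξ p (τ • a' + (1 - τ) • a) := by
    intro a ha a' ha' τ hτ
    have h := hconv ξ a ha a' ha' τ hτ
    have e : ∑ i, (τ • a' + (1 - τ) • a) i * G.rate1 ξ i * p i =
        τ * ∑ i, a' i * G.rate1 ξ i * p i + (1 - τ) * ∑ i, a i * G.rate1 ξ i * p i := by
      rw [Finset.mul_sum, Finset.mul_sum, ← Finset.sum_add_distrib]
      refine Finset.sum_congr rfl fun i _ => ?_
      simp
      ring
    unfold preHam
    rw [e]
    linarith
  have hcont : ContinuousOn (G.preHam ξ p) (orthant m) := by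
    unfold preHam
    refine (G.cost_continuous ξ).add (Continuous.continuousOn ?_)
    fun_prop
  have hclosed : IsClosed (orthant m) := by
    have : orthant m = ⋂ i, {a : RateVec m | 0 ≤ a i} := by ext; simp [orthant]
    rw [this]
    refine isClosed_iInter fun i => isClosed_le continuous_const ?_
    fun_prop
  have h0 : (0 : RateVec m) ∈ orthant m := by intro i; simp
  have hmid : ∀ a ∈ orthant m, ∀ τ ∈ Icc (0 : ℝ) 1, ∀ a' ∈ orthant m,
      τ • a' + (1 - τ) • a ∈ orthant m := by
    intro a ha τ hτ a' ha' i
    have := mul_nonneg hτ.1 (ha' i)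
    have := mul_nonneg (sub_nonneg.2 hτ.2) (ha i)
    simp
    linarith
  -- a lower bound on the unit ball
  have hK : IsCompact (orthant m ∩ Metric.closedBall 0 1) :=
    (isCompact_closedBall _ _).inter_left hclosed
  obtain ⟨b, hb, hbmin⟩ := hK.exists_isMinOn ⟨0, h0, by simp⟩ (hcont.mono inter_subset_left)
  set D := G.preHam ξ p 0 - G.preHam ξ p b with hD
  have hgrow : ∀ a ∈ orthant m, 1 + D / γ < ‖a‖ → G.preHam ξ p 0 < G.preHam ξ p a := by
    intro a ha hlt
    have hD0 : 0 ≤ D := by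
      have : G.preHam ξ p b ≤ G.preHam ξ p 0 := hbmin ⟨h0, by simp⟩
      linarith
    have hn : 1 < ‖a‖ := lt_of_le_of_lt (by have := div_nonneg hD0 hγ.le; linarith) hlt
    have hn0 : 0 < ‖a‖ := by linarith
    have hτ : ‖a‖⁻¹ ∈ Icc (0 : ℝ) 1 := ⟨by positivity, inv_le_one_of_one_le₀ hn.le⟩
    have h := hc 0 h0 a ha _ hτ
    have hm := hmid 0 h0 _ hτ a ha
    have hle : G.preHam ξ p b ≤ G.preHam ξ p (‖a‖⁻¹ • a + (1 - ‖a‖⁻¹) • 0) := by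
      refine hbmin ⟨hm, ?_⟩
      simp [norm_smul, hn0.ne']
    have h1 : γ * ‖a‖⁻¹ * (1 - ‖a‖⁻¹) * ‖a - 0‖ ^ 2 = γ * (‖a‖ - 1) := by
      rw [sub_zero]; field_simp
    have h2 : D < γ * (‖a‖ - 1) := by
      have := (div_lt_iff₀ hγ).1 (show D / γ < ‖a‖ - 1 by linarith)
      linarith
    rw [h1] at h
    have h3 : 0 < ‖a‖⁻¹ * (G.preHam ξ p a - G.preHam ξ p 0) := by
      have : ‖a‖⁻¹ * (G.preHam ξ p a - G.preHam ξ p 0) =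
        ‖a‖⁻¹ * G.preHam ξ p a + (1 - ‖a‖⁻¹) * G.preHam ξ p 0 - G.preHam ξ p 0 := by ring
      rw [this]
      linarith
    have := (mul_pos_iff_of_pos_left (by positivity : (0 : ℝ) < ‖a‖⁻¹)).1 h3
    linarith
  have hK' : IsCompact (orthant m ∩ Metric.closedBall 0 (|1 + D / γ|)) :=
    (isCompact_closedBall _ _).inter_left hclosed
  obtain ⟨a, ha, hamin⟩ := hK'.exists_isMinOn ⟨0, h0, by simp⟩ (hcont.mono inter_subset_left)
  refine ⟨a, ⟨ha.1, fun c hcm => ?_⟩, ?_⟩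
  · by_cases hcn : ‖c‖ ≤ |1 + D / γ|
    · exact hamin ⟨hcm, by simpa using hcn⟩
    · have h1 := hgrow c hcm (lt_of_le_of_lt (le_abs_self _) (not_le.1 hcn))
      have h2 : G.preHam ξ p a ≤ G.preHam ξ p 0 := hamin ⟨h0, by simp⟩
      exact h2.trans h1.le
  · rintro c ⟨hcm, hcmin⟩
    have hamin' : G.preHam ξ p a ≥ G.preHam ξ p c := hcmin ha.1
    have hhalf : (1 / 2 : ℝ) ∈ Icc (0 : ℝ) 1 := by constructor <;> norm_num
    have h := hc a ha.1 c hcm _ hhalf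
    have h1 : G.preHam ξ p c ≤ _ := hcmin (hmid a ha.1 _ hhalf c hcm)
    have h2 : G.preHam ξ p a ≤ G.preHam ξ p c := by
      by_cases hcn : ‖c‖ ≤ |1 + D / γ|
      · exact hamin ⟨hcm, by simpa using hcn⟩
      · have h1 := hgrow c hcm (lt_of_le_of_lt (le_abs_self _) (not_le.1 hcn))
        have h2 : G.preHam ξ p a ≤ G.preHam ξ p 0 := hamin ⟨h0, by simp⟩
        exact h2.trans h1.le
    have h3 : γ * ‖c - a‖ ^ 2 ≤ 0 := by linarith
    have h4 : ‖c - a‖ ^ 2 = 0 :=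
      le_antisymm (nonpos_of_mul_nonpos_right h3 hγ) (by positivity)
    exact sub_eq_zero.1 (norm_eq_zero.1 (pow_eq_zero_iff (two_ne_zero) |>.1 h4))

/-- The unique minimizer `α̂(x, μ, p)`. -/
def argmin (ξ : State m N) (p : RateVec m) : RateVec m := (G.exists_argmin ξ p).choose

/-- The feedback control `(t, x, μ) ↦ α̂(x, μ, Δ_x v(t, ·, μ))`. -/
def feedback (v : ℝ → State m N → ℝ) : Control m N := fun t ξ => G.argmin ξ (diffVec (v t) ξ)

/-- The best response `α*(β) = α̂(x, μ, Δ_x v^β)`. -/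
def bestResponse (β : Control m N) : Control m N := G.feedback (G.value β)

/-- Symmetric Markov perfect equilibria: admissible `α` with `α = α*(α)` on `[0,T] × State`. -/
def IsMPE (α : Control m N) : Prop :=
  G.Admissible α ∧ ∀ t ∈ Icc 0 G.T, α t = G.bestResponse α t

/-- `v` is a classical solution of the dynamic programming equation HJB(β) on `[0,T]`, with
one-sided derivatives at the end points. For admissible `β` the right side is continuous in time,
so that `v` is continuously differentiable. -/
def IsHJBSolution (β : Control m N) (v : ℝ → State m N → ℝ) : Prop :=
  (∀ t ∈ Icc 0 G.T, ∀ ξ, HasDerivWithinAt (fun s => v s ξ)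
    (-(G.H ξ (diffVec (v t) ξ) + G.genMu (β t) (v t) ξ)) (Icc 0 G.T) t) ∧
    ∀ ξ, v G.T ξ = G.terminal ξ

/-- `v` is a classical solution of the Nash-Lasry-Lions system on `[0,T]`. -/
def IsNLLSolution (v : ℝ → State m N → ℝ) : Prop := G.IsHJBSolution (G.feedback v) v

/-- The controls `β⁽ⁿ⁾`, `n ≥ 0`, of the Picard iteration (`ρ = 0`) and of the weighted Picard
iteration (`0 < ρ < 1`) started from `β⁽⁰⁾`. -/
def iterBeta (ρ : ℝ) (β0 : Control m N) : ℕ → Control m N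
  | 0 => β0
  | n + 1 => fun t ξ =>
      ρ • iterBeta ρ β0 n t ξ + (1 - ρ) • G.bestResponse (iterBeta ρ β0 n) t ξ

/-- The value functions: `iterValue ρ β⁽⁰⁾ n` is `v⁽ⁿ⁺¹⁾ = v^{β⁽ⁿ⁾}`. -/
def iterValue (ρ : ℝ) (β0 : Control m N) (n : ℕ) : ℝ → State m N → ℝ :=
  G.value (G.iterBeta ρ β0 n)

/-- The best responses: `iterAlpha ρ β⁽⁰⁾ n` is `α⁽ⁿ⁺¹⁾ = α*(β⁽ⁿ⁾)`. -/
def iterAlpha (ρ : ℝ) (β0 : Control m N) (n : ℕ) : Control m N :=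
  G.bestResponse (G.iterBeta ρ β0 n)

end Game

end SymGame

end

open Set Filter Topology

noncomputable section

/-! The state space is finite, so HJB and NLL are terminal value problems for ODEs in `State m N →
ℝ`. Strong convexity makes the minimizer Lipschitz in `p`, and `H` is concave, hence locally
Lipschitz; both right sides are thus locally Lipschitz, which alone does not exclude blow-up.
Solving first with values truncated to `[0, R]` and applying a maximum principle shows that the
truncation is never active (`exists_bounded_solution`).

Dynkin's formula writes the cost of `α` as a solution of HJB plus the expected integral of a
nonnegative suboptimality `gap`, which vanishes for the feedback of that solution. So every solution
of HJB is the value function (`value_eq`). This gives uniqueness for HJB and the bound `R` for all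
solutions. An NLL solution solves HJB against its own feedback, so it obeys the same bound, and
Gronwall on a compact box gives uniqueness. Equilibria correspond to NLL solutions through value
function and feedback.

For convergence, distances are measured with the weight `exp (θ (T - t))`. For large `θ`, a Gronwall
barrier makes the distance from the value function to `v` a small multiple `δ` of the distance from
the control to the equilibrium, so a best response halves the latter (`exists_contraction`).
Averaging with weight `ρ` contracts by `ρ + (1 - ρ) / 2 < 1`. -/

/-! ### Existence and comparison for ordinary differential equations -/

theorem locallyLipschitz_pi {α ι : Type*} {β : ι → Type*} [Fintype ι] [PseudoEMetricSpace α]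
    [∀ i, PseudoEMetricSpace (β i)] {f : α → ∀ i, β i}
    (h : ∀ i, LocallyLipschitz fun x => f x i) : LocallyLipschitz f := by
  intro x
  choose K t ht hK using fun i => h i x
  refine ⟨∑ i, K i, ⋂ i, t i, (iInter_mem).2 ht, fun y hy z hz => ?_⟩
  refine edist_pi_le_iff.2 fun i => ?_
  refine (hK i (mem_iInter.1 hy i) (mem_iInter.1 hz i)).trans ?_
  gcongr
  exact Finset.single_le_sum (f := K) (fun _ _ => zero_le) (Finset.mem_univ i)

/-- Composing with the bounded map `C` confines `Θ` to a compact set, where it is Lipschitz and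
bounded; hence the solution is global. `C` will be a truncation. -/
theorem exists_hasDerivWithinAt_of_locallyLipschitz {P E : Type*} [NormedAddCommGroup P]
    [NormedAddCommGroup E] [NormedSpace ℝ E] [ProperSpace E] {Θ : P × E → E}
    (hΘ : LocallyLipschitz Θ) {C : E → E} {k : NNReal} (hC : LipschitzWith k C)
    (hb : Bornology.IsBounded (range C)) {a b t₀ : ℝ} (ht₀ : t₀ ∈ Icc a b) {q : ℝ → P}
    (hq : ContinuousOn q (Icc a b)) (x₀ : E) :
    ∃ f : ℝ → E, f t₀ = x₀ ∧
      ∀ t ∈ Icc a b, HasDerivWithinAt f (Θ (q t, C (f t))) (Icc a b) t := by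
  have hS : IsCompact ((q '' Icc a b) ×ˢ closure (range C)) :=
    (isCompact_Icc.image_of_continuousOn hq).prod hb.isCompact_closure
  obtain ⟨K, hK⟩ := (hΘ.locallyLipschitzOn (s := _)).exists_lipschitzOnWith_of_compact hS
  obtain ⟨L, hL⟩ := hS.exists_bound_of_continuousOn hΘ.continuous.continuousOn
  have hmem : ∀ t ∈ Icc a b, ∀ x, (q t, C x) ∈ (q '' Icc a b) ×ˢ closure (range C) :=
    fun t ht x => ⟨mem_image_of_mem q ht, subset_closure (mem_range_self x)⟩
  -- The radius is the distance a curve of speed at most `L` can cover, so the solution reaches both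
  -- ends of the interval.
  have hPL : IsPicardLindelof (fun t x => Θ (q t, C x)) (⟨t₀, ht₀⟩ : Icc a b) x₀
      (L.toNNReal * (max (b - t₀) (t₀ - a)).toNNReal) 0 L.toNNReal (K * k) := by
    refine ⟨fun t ht x _ y _ => ?_, fun x _ => ?_, fun t ht x _ => ?_, ?_⟩
    · refine (hK (hmem t ht x) (hmem t ht y)).trans ?_
      rw [ENNReal.coe_mul, mul_assoc]
      gcongr
      rw [Prod.edist_eq]
      simpa using hC x y
    · exact hΘ.continuous.comp_continuousOn (hq.prodMk continuousOn_const)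
    · exact (hL _ (hmem t ht x)).trans (Real.le_coe_toNNReal L)
    · have : 0 ≤ max (b - t₀) (t₀ - a) := le_max_of_le_left (sub_nonneg.2 ht₀.2)
      simp [Real.coe_toNNReal _ this]
  obtain ⟨f, hf, hf'⟩ := hPL.exists_eq_forall_mem_Icc_hasDerivWithinAt₀
  exact ⟨f, hf, hf'⟩

/-- Maximum principle backward in time: only maxima over the states need control, because a joint
maximum over time and state is one of them. -/
theorem le_add_mul_of_neg_deriv_le_at_max {S : Type*} [Finite S] {u u' : ℝ → S → ℝ}
    {a T g K : ℝ}
    (hu : ∀ t ∈ Icc a T, ∀ ξ, HasDerivWithinAt (fun s => u s ξ) (u' t ξ) (Icc a T) t)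
    (hmax : ∀ t ∈ Icc a T, ∀ ξ, (∀ η, u t η ≤ u t ξ) → -u' t ξ ≤ K)
    (hT : ∀ ξ, u T ξ ≤ g) : ∀ t ∈ Icc a T, ∀ ξ, u t ξ ≤ g + K * (T - t) := by
  intro t₁ ht₁ ξ₁
  refine le_of_forall_pos_le_add fun ε hε => ?_
  have hTa : 0 ≤ T - a := sub_nonneg.2 (ht₁.1.trans ht₁.2)
  -- The extra slope `c` makes the inequality strict, so `w` cannot attain its maximum before `T`;
  -- over the whole interval it costs at most `ε`.
  set c : ℝ := ε / (T - a + 1) with hc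
  have hcpos : 0 < c := by positivity
  set w : ℝ → S → ℝ := fun t ξ => u t ξ - (K + c) * (T - t) with hw
  have hw' : ∀ t ∈ Icc a T, ∀ ξ,
      HasDerivWithinAt (fun s => w s ξ) (u' t ξ + (K + c)) (Icc a T) t := by
    intro t ht ξ
    have h := (hu t ht ξ).sub ((((hasDerivAt_id t).const_sub T).const_mul (K + c)).hasDerivWithinAt
      (s := Icc a T))
    exact h.congr_deriv (by ring)
  have key : ∀ ξ t, t ∈ Icc a T → w t ξ ≤ g := by
    have hne : (Icc a T).Nonempty := ⟨t₁, ht₁⟩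
    have hex : ∀ ξ, ∃ t ∈ Icc a T, IsMaxOn (fun s => w s ξ) (Icc a T) t := fun ξ =>
      isCompact_Icc.exists_isMaxOn hne fun t ht => (hw' t ht ξ).continuousWithinAt
    choose τ hτ hτmax using hex
    have : Nonempty S := ⟨ξ₁⟩
    obtain ⟨ξ₀, hξ₀⟩ := Finite.exists_max fun ξ => w (τ ξ) ξ
    have hle : ∀ ξ t, t ∈ Icc a T → w t ξ ≤ w (τ ξ₀) ξ₀ :=
      fun ξ t ht => (hτmax ξ ht).trans (hξ₀ ξ)
    suffices w (τ ξ₀) ξ₀ ≤ g from fun ξ t ht => (hle ξ t ht).trans this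
    rcases (hτ ξ₀).2.eq_or_lt with h | h
    · simp only [hw, h, sub_self, mul_zero, sub_zero]
      exact hT ξ₀
    · exfalso
      have h1 : ∀ η, u (τ ξ₀) η ≤ u (τ ξ₀) ξ₀ := by
        intro η
        have := hle η _ (hτ ξ₀)
        simp only [hw] at this
        linarith
      have h2 := hmax _ (hτ ξ₀) ξ₀ h1
      have h3 := (hτmax ξ₀).localize.hasFDerivWithinAt_nonpos
        (hw' _ (hτ ξ₀) ξ₀).hasFDerivWithinAt
        (sub_mem_posTangentConeAt_of_segment_subset
          ((convex_Icc a T).segment_subset (hτ ξ₀) (right_mem_Icc.2 (by linarith))))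
      have h4 : (T - τ ξ₀) * (u' (τ ξ₀) ξ₀ + (K + c)) ≤ 0 := by simpa using h3
      have h5 := nonpos_of_mul_nonpos_right h4 (sub_pos.2 h)
      linarith
  have h := key ξ₁ t₁ ht₁
  simp only [hw] at h
  have h1 : c * (T - t₁) ≤ ε := by
    rw [hc, div_mul_eq_mul_div, div_le_iff₀ (by linarith)]
    have := ht₁.1
    nlinarith
  linarith

/-- After time reversal the right side is a barrier: at a contact point the speed of `u` is at most
`C (δ + 1) A e^{θ s}`, and `hθ` says that the barrier grows faster. Any `δ > 0` is allowed if `θ` is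
large. -/
theorem norm_le_exp_of_norm_deriv_le {E : Type*} [NormedAddCommGroup E] [NormedSpace ℝ E]
    {u u' : ℝ → E} {T A C δ θ : ℝ}
    (hu : ∀ t ∈ Icc 0 T, HasDerivWithinAt u (u' t) (Icc 0 T) t) (hT : u T = 0) (hA : 0 < A)
    (hδ : 0 < δ) (hθ : C * (δ + 1) < θ * δ)
    (hb : ∀ t ∈ Icc 0 T, ‖u' t‖ ≤ C * (‖u t‖ + A * Real.exp (θ * (T - t)))) :
    ∀ t ∈ Icc 0 T, ‖u t‖ ≤ δ * (A * Real.exp (θ * (T - t))) := by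
  have hmaps : MapsTo (fun s => T - s) (Icc 0 T) (Icc 0 T) := fun s hs =>
    ⟨by linarith [hs.2], by linarith [hs.1]⟩
  have hf : ∀ s ∈ Icc 0 T, HasDerivWithinAt (fun s => u (T - s)) (-(u' (T - s))) (Icc 0 T) s := by
    intro s hs
    have h := (hu (T - s) (hmaps hs)).scomp s
      (((hasDerivAt_id s).const_sub T).hasDerivWithinAt (s := Icc 0 T)) hmaps
    simpa [Function.comp_def] using h
  have key := image_norm_le_of_norm_deriv_right_lt_deriv_boundary (a := 0) (b := T)
    (f := fun s => u (T - s)) (f' := fun s => -(u' (T - s)))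
    (B := fun s => δ * (A * Real.exp (θ * s))) (B' := fun s => δ * (A * (Real.exp (θ * s) * θ)))
    (fun s hs => (hf s hs).continuousWithinAt)
    (fun s hs => (hf s (Ico_subset_Icc_self hs)).mono_of_mem_nhdsWithin
      (Icc_mem_nhdsGE_of_mem hs))
    (by simp [hT]; positivity)
    (fun s => by
      have h := (((hasDerivAt_id s).const_mul θ).exp.const_mul A).const_mul δ
      simpa using h)
    (fun s hs h => by
      have h1 := hb (T - s) (hmaps (Ico_subset_Icc_self hs))
      rw [h, sub_sub_cancel] at h1
      rw [norm_neg]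
      refine h1.trans_lt ?_
      have := mul_lt_mul_of_pos_right hθ (mul_pos hA (Real.exp_pos (θ * s)))
      nlinarith)
  intro t ht
  simpa using key (hmaps ht)

theorem eqOn_zero_of_norm_deriv_le {E : Type*} [NormedAddCommGroup E] [NormedSpace ℝ E]
    {u u' : ℝ → E} {T C : ℝ} (hC : 0 ≤ C)
    (hu : ∀ t ∈ Icc 0 T, HasDerivWithinAt u (u' t) (Icc 0 T) t) (hT : u T = 0)
    (hb : ∀ t ∈ Icc 0 T, ‖u' t‖ ≤ C * ‖u t‖) : ∀ t ∈ Icc 0 T, u t = 0 := by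
  intro t ht
  -- With no forcing term the barrier works for every `A > 0`; then `A` tends to `0`.
  have h : ∀ A : ℝ, 0 < A → ‖u t‖ ≤ A * Real.exp ((2 * C + 1) * (T - t)) := fun A hA => by
    have := norm_le_exp_of_norm_deriv_le (δ := 1) (θ := 2 * C + 1) (C := C) hu hT hA one_pos
      (by linarith)
      (fun s hs => (hb s hs).trans (by gcongr; simp; positivity)) t ht
    simpa using this
  refine norm_le_zero_iff.1 (le_of_forall_pos_le_add fun ε hε => ?_)
  have := h (ε / Real.exp ((2 * C + 1) * (T - t))) (by positivity)
  rwa [div_mul_cancel₀ _ (Real.exp_pos _).ne', ← zero_add ε] at this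

/-! ### Regularity of the minimizer, the Hamiltonian and the generators -/

namespace SymGame

variable {m N : ℕ}

theorem zero_mem_orthant : (0 : RateVec m) ∈ orthant m := fun i => by simp

theorem convex_orthant : Convex ℝ (orthant m) := by
  intro a ha b hb s t hs ht _ i
  have := mul_nonneg hs (ha i)
  have := mul_nonneg ht (hb i)
  simp
  linarith

theorem contDiff_diffVec (ξ : State m N) :
    ContDiff ℝ 1 fun φ : State m N → ℝ => diffVec φ ξ := by
  unfold diffVec
  rw [contDiff_euclidean]
  intro i
  simp only
  fun_prop

namespace Game

variable (G : Game m N)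

theorem argmin_mem (ξ : State m N) (p : RateVec m) : G.argmin ξ p ∈ orthant m :=
  (G.exists_argmin ξ p).choose_spec.1.1

theorem preHam_argmin_le (ξ : State m N) (p : RateVec m) {a : RateVec m} (ha : a ∈ orthant m) :
    G.preHam ξ p (G.argmin ξ p) ≤ G.preHam ξ p a :=
  (G.exists_argmin ξ p).choose_spec.1.2 ha

/-- Strong convexity at the midpoint of `a` and the minimizer, where the value is at least the
minimum; hence half the convexity constant. -/
theorem exists_quadratic_growth : ∃ γ : ℝ, 0 < γ ∧ ∀ ξ p, ∀ a ∈ orthant m,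
    G.preHam ξ p (G.argmin ξ p) + γ * ‖a - G.argmin ξ p‖ ^ 2 ≤ G.preHam ξ p a := by
  obtain ⟨γ, hγ, hconv⟩ := G.cost_strongConvex
  refine ⟨γ / 2, half_pos hγ, fun ξ p a ha => ?_⟩
  set b := G.argmin ξ p with hb
  have h := hconv ξ b (G.argmin_mem ξ p) a ha (1 / 2) ⟨by norm_num, by norm_num⟩
  have hmin := G.preHam_argmin_le ξ p (a := (1 / 2 : ℝ) • a + (1 - 1 / 2 : ℝ) • b)
    (convex_orthant ha (G.argmin_mem ξ p) (by norm_num) (by norm_num) (by norm_num))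
  have e : ∑ i, ((1 / 2 : ℝ) • a + (1 - 1 / 2 : ℝ) • b) i * G.rate1 ξ i * p i =
      1 / 2 * ∑ i, a i * G.rate1 ξ i * p i + 1 / 2 * ∑ i, b i * G.rate1 ξ i * p i := by
    rw [Finset.mul_sum, Finset.mul_sum, ← Finset.sum_add_distrib]
    refine Finset.sum_congr rfl fun i _ => ?_
    simp
    ring
  rw [← hb] at hmin
  unfold preHam at hmin ⊢
  rw [e] at hmin
  linarith

/-- Adding the growth inequalities for `p` and `q`, each tested with the other minimizer, cancels
the costs and leaves `2γ‖a - b‖²` below a form bilinear in `b - a` and `p - q`. Summing the rates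
over all states makes the constant uniform. -/
theorem exists_lipschitzWith_argmin : ∃ K : NNReal, ∀ ξ, LipschitzWith K (G.argmin ξ) := by
  obtain ⟨γ, hγ, hgrow⟩ := G.exists_quadratic_growth
  have hr : ∀ ξ, 0 ≤ ∑ i, G.rate1 ξ i := fun ξ => Finset.sum_nonneg fun i _ => G.rate1_nonneg ξ i
  have hR : 0 ≤ ∑ ξ, ∑ i, G.rate1 ξ i := Finset.sum_nonneg fun ξ _ => hr ξ
  refine ⟨((∑ ξ, ∑ i, G.rate1 ξ i) / (2 * γ)).toNNReal, fun ξ =>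
    LipschitzWith.of_dist_le_mul fun p q => ?_⟩
  rw [Real.coe_toNNReal _ (by positivity), dist_eq_norm, dist_eq_norm, div_mul_eq_mul_div,
    le_div_iff₀ (by positivity)]
  set a := G.argmin ξ p
  set b := G.argmin ξ q
  have h1 : G.preHam ξ p a + γ * ‖b - a‖ ^ 2 ≤ G.preHam ξ p b := hgrow ξ p b (G.argmin_mem ξ q)
  have h2 : G.preHam ξ q b + γ * ‖a - b‖ ^ 2 ≤ G.preHam ξ q a := hgrow ξ q a (G.argmin_mem ξ p)
  have h3 : G.preHam ξ p b - G.preHam ξ p a + (G.preHam ξ q a - G.preHam ξ q b) =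
      ∑ i, (b - a) i * G.rate1 ξ i * (p - q) i := by
    unfold preHam
    rw [show ∀ x y z w s t u v : ℝ, x + y - (z + w) + (z + t - (x + v)) = (y - w) + (t - v) by
      intros; ring, ← Finset.sum_sub_distrib, ← Finset.sum_sub_distrib, ← Finset.sum_add_distrib]
    · refine Finset.sum_congr rfl fun i _ => ?_
      simp
      ring
    -- The quantified `s` and `u` do not occur in the identity, so the rewrite leaves them as goals.
    all_goals exact 0
  have h4 : ∑ i, (b - a) i * G.rate1 ξ i * (p - q) i ≤
      (∑ ξ, ∑ i, G.rate1 ξ i) * ‖p - q‖ * ‖a - b‖ := by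
    calc ∑ i, (b - a) i * G.rate1 ξ i * (p - q) i
        ≤ ∑ i, ‖a - b‖ * G.rate1 ξ i * ‖p - q‖ := by
          refine Finset.sum_le_sum fun i _ => (le_abs_self _).trans ?_
          rw [abs_mul, abs_mul, abs_of_nonneg (G.rate1_nonneg ξ i), norm_sub_rev a b]
          have := G.rate1_nonneg ξ i
          gcongr
          · exact PiLp.norm_apply_le (b - a) i
          · exact PiLp.norm_apply_le (p - q) i
      _ = (∑ i, G.rate1 ξ i) * ‖p - q‖ * ‖a - b‖ := by
          rw [Finset.sum_mul, Finset.sum_mul]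
          exact Finset.sum_congr rfl fun i _ => by ring
      _ ≤ _ := by
          gcongr
          exact Finset.single_le_sum (f := fun ξ => ∑ i, G.rate1 ξ i) (fun ξ _ => hr ξ)
            (Finset.mem_univ ξ)
  rw [norm_sub_rev b a] at h1
  rcases (norm_nonneg (a - b)).eq_or_lt with h | h
  · rw [← h, zero_mul]
    positivity
  · refine le_of_mul_le_mul_right ?_ h
    nlinarith

theorem cost_add_sum_eq_preHam (ξ : State m N) (p a : RateVec m) :
    G.cost ξ a + ∑ i, (G.rate0 ξ i + G.rate1 ξ i * a i) * p i =
      G.preHam ξ p a + ∑ i, G.rate0 ξ i * p i := by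
  rw [preHam, add_assoc, ← Finset.sum_add_distrib]
  congr 1
  exact Finset.sum_congr rfl fun i _ => by ring

theorem H_eq (ξ : State m N) (p : RateVec m) :
    G.H ξ p = G.cost ξ (G.argmin ξ p) +
      ∑ i, (G.rate0 ξ i + G.rate1 ξ i * G.argmin ξ p i) * p i := by
  have hle : ∀ a : orthant m, G.cost ξ (G.argmin ξ p) +
      ∑ i, (G.rate0 ξ i + G.rate1 ξ i * G.argmin ξ p i) * p i ≤
      G.cost ξ a.1 + ∑ i, (G.rate0 ξ i + G.rate1 ξ i * a.1 i) * p i := by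
    intro a
    rw [cost_add_sum_eq_preHam, cost_add_sum_eq_preHam]
    have := G.preHam_argmin_le ξ p a.2
    linarith
  have : Nonempty (orthant m) := ⟨⟨0, zero_mem_orthant⟩⟩
  refine le_antisymm ?_ (le_ciInf hle)
  exact ciInf_le ⟨_, by rintro _ ⟨a, rfl⟩; exact hle a⟩ (⟨_, G.argmin_mem ξ p⟩ : orthant m)

theorem H_le (ξ : State m N) (p : RateVec m) {a : RateVec m} (ha : a ∈ orthant m) :
    G.H ξ p ≤ G.cost ξ a + ∑ i, (G.rate0 ξ i + G.rate1 ξ i * a i) * p i := by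
  have h := G.preHam_argmin_le ξ p ha
  rw [H_eq, cost_add_sum_eq_preHam, cost_add_sum_eq_preHam]
  linarith

/-- An infimum of affine functions of `p`. Finite concave functions on a finite-dimensional space
are locally Lipschitz, which is how this is used. -/
theorem concaveOn_H (ξ : State m N) : ConcaveOn ℝ univ (G.H ξ) := by
  refine ⟨convex_univ, fun p _ q _ s t hs ht _ => ?_⟩
  set a := G.argmin ξ (s • p + t • q)
  have hp := G.H_le ξ p (G.argmin_mem ξ (s • p + t • q))
  have hq := G.H_le ξ q (G.argmin_mem ξ (s • p + t • q))
  have e : ∑ i, (G.rate0 ξ i + G.rate1 ξ i * a i) * (s • p + t • q) i =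
      s * ∑ i, (G.rate0 ξ i + G.rate1 ξ i * a i) * p i +
        t * ∑ i, (G.rate0 ξ i + G.rate1 ξ i * a i) * q i := by
    rw [Finset.mul_sum, Finset.mul_sum, ← Finset.sum_add_distrib]
    refine Finset.sum_congr rfl fun i _ => ?_
    simp
    ring
  rw [G.H_eq ξ (s • p + t • q), e, smul_eq_mul, smul_eq_mul]
  have h1 := mul_le_mul_of_nonneg_left hp hs
  have h2 := mul_le_mul_of_nonneg_left hq ht
  have h3 : s * G.cost ξ a + t * G.cost ξ a = G.cost ξ a := by rw [← add_mul]; simp [*]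
  linarith

theorem locallyLipschitz_H (ξ : State m N) : LocallyLipschitz (G.H ξ) := by
  rw [← locallyLipschitzOn_univ]
  exact (G.concaveOn_H ξ).locallyLipschitzOn isOpen_univ

theorem contDiff_genX (ξ : State m N) :
    ContDiff ℝ 1 fun q : (State m N → RateVec m) × (State m N → ℝ) => G.genX q.1 q.2 ξ := by
  unfold genX
  fun_prop

theorem contDiff_genMu (ξ : State m N) :
    ContDiff ℝ 1 fun q : (State m N → RateVec m) × (State m N → ℝ) => G.genMu q.1 q.2 ξ := by
  unfold genMu
  fun_prop

/-- The right side `H(x, μ, Δ_x φ) + L^b_μ φ` of the dynamic programming equation. -/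
def hjbField (b : State m N → RateVec m) (φ : State m N → ℝ) (ξ : State m N) : ℝ :=
  G.H ξ (diffVec φ ξ) + G.genMu b φ ξ

theorem locallyLipschitz_hjbField : LocallyLipschitz
    fun q : (State m N → RateVec m) × (State m N → ℝ) => G.hjbField q.1 q.2 :=
  locallyLipschitz_pi fun ξ =>
    ((G.locallyLipschitz_H ξ).comp
      (((contDiff_diffVec ξ).comp contDiff_snd).locallyLipschitz)).add
      (G.contDiff_genMu ξ).locallyLipschitz

/-- The feedback `ξ ↦ α̂(ξ, Δ_x φ)` determined by a function of the state. -/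
def feedbackMap (φ : State m N → ℝ) (ξ : State m N) : RateVec m := G.argmin ξ (diffVec φ ξ)

theorem locallyLipschitz_feedbackMap : LocallyLipschitz G.feedbackMap := by
  obtain ⟨K, hK⟩ := G.exists_lipschitzWith_argmin
  exact locallyLipschitz_pi fun ξ =>
    (hK ξ).locallyLipschitz.comp (contDiff_diffVec ξ).locallyLipschitz

theorem feedbackMap_mem (φ : State m N → ℝ) (ξ : State m N) : G.feedbackMap φ ξ ∈ orthant m :=
  G.argmin_mem _ _

theorem genMu_nonpos_of_max {b : State m N → RateVec m} (hb : ∀ ξ, b ξ ∈ orthant m)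
    {φ : State m N → ℝ} {ξ : State m N} (h : ∀ η, φ η ≤ φ ξ) : G.genMu b φ ξ ≤ 0 := by
  refine Finset.sum_nonpos fun z _ => Finset.sum_nonpos fun _ _ => ?_
  refine mul_nonpos_of_nonneg_of_nonpos (mul_nonneg (Nat.cast_nonneg _) (add_nonneg
    (G.rate0_nonneg _ _) (mul_nonneg (G.rate1_nonneg _ _) (hb _ _)))) (sub_nonpos.2 (h _))

theorem genX_nonpos_of_max {a : State m N → RateVec m} (ha : ∀ ξ, a ξ ∈ orthant m)
    {φ : State m N → ℝ} {ξ : State m N} (h : ∀ η, φ η ≤ φ ξ) : G.genX a φ ξ ≤ 0 :=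
  Finset.sum_nonpos fun _ _ => mul_nonpos_of_nonneg_of_nonpos (add_nonneg
    (G.rate0_nonneg _ _) (mul_nonneg (G.rate1_nonneg _ _) (ha _ _))) (sub_nonpos.2 (h _))

theorem genX_neg (a : State m N → RateVec m) (φ : State m N → ℝ) (ξ : State m N) :
    G.genX a (fun η => -φ η) ξ = -G.genX a φ ξ := by
  simp only [genX, ← Finset.sum_neg_distrib]
  refine Finset.sum_congr rfl fun i _ => by ring

theorem genMu_neg (b : State m N → RateVec m) (φ : State m N → ℝ) (ξ : State m N) :
    G.genMu b (fun η => -φ η) ξ = -G.genMu b φ ξ := by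
  simp only [genMu, ← Finset.sum_neg_distrib]
  refine Finset.sum_congr rfl fun z _ => Finset.sum_congr rfl fun i _ => by ring

theorem genX_sum {ι : Type*} (s : Finset ι) (c : ι → ℝ) (f : ι → State m N → ℝ)
    (a : State m N → RateVec m) (ξ : State m N) :
    G.genX a (fun η => ∑ j ∈ s, c j * f j η) ξ = ∑ j ∈ s, c j * G.genX a (f j) ξ := by
  simp only [genX, Finset.mul_sum]
  rw [Finset.sum_comm]
  refine Finset.sum_congr rfl fun i _ => ?_
  rw [← Finset.sum_sub_distrib, Finset.mul_sum]
  exact Finset.sum_congr rfl fun j _ => by ring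

theorem genMu_sum {ι : Type*} (s : Finset ι) (c : ι → ℝ) (f : ι → State m N → ℝ)
    (b : State m N → RateVec m) (ξ : State m N) :
    G.genMu b (fun η => ∑ j ∈ s, c j * f j η) ξ = ∑ j ∈ s, c j * G.genMu b (f j) ξ := by
  simp only [genMu, Finset.mul_sum]
  conv_rhs => rw [Finset.sum_comm]
  refine Finset.sum_congr rfl fun z _ => ?_
  conv_rhs => rw [Finset.sum_comm]
  refine Finset.sum_congr rfl fun i _ => ?_
  rw [← Finset.sum_sub_distrib, Finset.mul_sum]
  exact Finset.sum_congr rfl fun j _ => by ring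

end Game
end SymGame

/-! ### Truncation, a priori bounds and existence of solutions -/

namespace SymGame

variable {m N : ℕ}

/-- Truncation of a function to the values in `[0, R]`. -/
def clip {S : Type*} (R : ℝ) (φ : S → ℝ) (ξ : S) : ℝ := max 0 (min (φ ξ) R)

theorem lipschitzWith_clip {S : Type*} [Fintype S] (R : ℝ) :
    LipschitzWith 1 (clip (S := S) R) := by
  have h : LipschitzWith 1 fun x : ℝ => max 0 (min x R) :=
    (LipschitzWith.id.min_const R).const_max 0
  refine LipschitzWith.of_dist_le_mul fun φ ψ => (dist_pi_le_iff (by positivity)).2 fun ξ => ?_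
  refine (h.dist_le_mul _ _).trans ?_
  gcongr
  exact dist_le_pi_dist φ ψ ξ

theorem isBounded_range_clip {S : Type*} [Fintype S] {R : ℝ} (hR : 0 ≤ R) :
    Bornology.IsBounded (range (clip (S := S) R)) := by
  refine (Metric.isBounded_Icc (0 : S → ℝ) fun _ => R).subset ?_
  rintro _ ⟨φ, rfl⟩
  exact ⟨fun _ => le_max_left _ _, fun _ => max_le hR (min_le_right _ _)⟩

theorem clip_eq_self {S : Type*} {R : ℝ} {φ : S → ℝ} (h : ∀ ξ, φ ξ ∈ Icc 0 R) :
    clip R φ = φ := by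
  ext ξ
  rw [clip, min_eq_left (h ξ).2, max_eq_right (h ξ).1]

theorem clip_mono {S : Type*} {R : ℝ} {φ : S → ℝ} {ξ η : S} (h : φ ξ ≤ φ η) :
    clip R φ ξ ≤ clip R φ η :=
  max_le_max le_rfl (min_le_min h le_rfl)

theorem continuousOn_of_hasDerivWithinAt {E : Type*} [NormedAddCommGroup E] [NormedSpace ℝ E]
    {v v' : ℝ → E} {s : Set ℝ} (h : ∀ t ∈ s, HasDerivWithinAt v (v' t) s t) : ContinuousOn v s :=
  fun t ht => (h t ht).continuousWithinAt

namespace Game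

variable (G : Game m N)

/-- The bound `∑ g + T ∑ ℓ(·, 0)` for all value functions. -/
def valueBound : ℝ := ∑ ξ, G.terminal ξ + (∑ ξ, G.cost ξ 0) * G.T

theorem valueBound_nonneg : 0 ≤ G.valueBound :=
  add_nonneg (Finset.sum_nonneg fun ξ _ => G.terminal_nonneg ξ)
    (mul_nonneg (Finset.sum_nonneg fun ξ _ => G.cost_nonneg ξ 0 zero_mem_orthant) G.T_pos.le)

/-- At a maximum every jump lowers `φ`, so the action `0` in the Hamiltonian costs at most `ℓ(·,
0)`. -/
theorem hjbField_le_of_max {b : State m N → RateVec m} (hb : ∀ ξ, b ξ ∈ orthant m)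
    {φ : State m N → ℝ} {ξ : State m N} (h : ∀ η, φ η ≤ φ ξ) :
    G.hjbField b φ ξ ≤ ∑ η, G.cost η 0 := by
  have h1 := G.H_le ξ (diffVec φ ξ) zero_mem_orthant
  have h2 : ∑ i, (G.rate0 ξ i + G.rate1 ξ i * (0 : RateVec m) i) * diffVec φ ξ i ≤ 0 :=
    Finset.sum_nonpos fun i _ => mul_nonpos_of_nonneg_of_nonpos
      (by simpa using G.rate0_nonneg ξ i) (sub_nonpos.2 (h _))
  have h3 := G.genMu_nonpos_of_max hb h
  have h4 : G.cost ξ 0 ≤ ∑ η, G.cost η 0 :=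
    Finset.single_le_sum (f := fun η => G.cost η 0)
      (fun η _ => G.cost_nonneg η 0 zero_mem_orthant) (Finset.mem_univ ξ)
  unfold hjbField
  linarith

theorem hjbField_nonneg_of_min {b : State m N → RateVec m} (hb : ∀ ξ, b ξ ∈ orthant m)
    {φ : State m N → ℝ} {ξ : State m N} (h : ∀ η, φ ξ ≤ φ η) :
    0 ≤ G.hjbField b φ ξ := by
  have h3 := G.genMu_nonpos_of_max hb (φ := fun η => -φ η) fun η => neg_le_neg (h η)
  rw [genMu_neg] at h3
  have h2 : 0 ≤ ∑ i, (G.rate0 ξ i + G.rate1 ξ i * G.argmin ξ (diffVec φ ξ) i) * diffVec φ ξ i :=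
    Finset.sum_nonneg fun i _ => mul_nonneg (add_nonneg (G.rate0_nonneg ξ i)
      (mul_nonneg (G.rate1_nonneg ξ i) (G.argmin_mem _ _ i))) (sub_nonneg.2 (h _))
  have h4 := G.cost_nonneg ξ _ (G.argmin_mem ξ (diffVec φ ξ))
  rw [hjbField, H_eq]
  linarith

theorem isHJBSolution_iff {β : Control m N} {v : ℝ → State m N → ℝ} :
    G.IsHJBSolution β v ↔ (∀ t ∈ Icc 0 G.T,
      HasDerivWithinAt v (-G.hjbField (β t) (v t)) (Icc 0 G.T) t) ∧ v G.T = G.terminal := by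
  simp only [IsHJBSolution, hasDerivWithinAt_pi, funext_iff]
  rfl

/-- The general field `B` serves both equations: a prescribed control gives HJB, the feedback of the
unknown gives NLL. -/
theorem exists_bounded_solution
    {B : (State m N → RateVec m) × (State m N → ℝ) → State m N → RateVec m}
    (hB : LocallyLipschitz B) {q : Control m N} (hq : ContinuousOn q (Icc 0 G.T))
    (hmem : ∀ t ∈ Icc 0 G.T, ∀ φ ξ, B (q t, φ) ξ ∈ orthant m) :
    ∃ v : ℝ → State m N → ℝ, G.IsHJBSolution (fun t => B (q t, v t)) v ∧
      ∀ t ∈ Icc 0 G.T, ∀ ξ, v t ξ ∈ Icc 0 G.valueBound := by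
  have hΘ : LocallyLipschitz fun x : (State m N → RateVec m) × (State m N → ℝ) =>
      -G.hjbField (B x) x.2 :=
    (G.locallyLipschitz_hjbField.comp (hB.prodMk LipschitzWith.prod_snd.locallyLipschitz)).neg
  obtain ⟨v, hvT, hv⟩ := exists_hasDerivWithinAt_of_locallyLipschitz hΘ
    (lipschitzWith_clip G.valueBound) (isBounded_range_clip G.valueBound_nonneg)
    (right_mem_Icc.2 G.T_pos.le) hq G.terminal
  have hv' := fun t ht => hasDerivWithinAt_pi.1 (hv t ht)
  -- Truncation is monotone, so a maximum of `v t` is one of its truncation, and the bounds hold for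
  -- the truncated equation.
  have hle := le_add_mul_of_neg_deriv_le_at_max (g := ∑ ξ, G.terminal ξ) (K := ∑ ξ, G.cost ξ 0) hv'
    (fun t ht ξ h => by
      rw [Pi.neg_apply, neg_neg]
      exact G.hjbField_le_of_max (hmem t ht _) fun η => clip_mono (h η))
    (fun ξ => by
      rw [hvT]
      exact Finset.single_le_sum (f := G.terminal) (fun η _ => G.terminal_nonneg η)
        (Finset.mem_univ ξ))
  have hge := le_add_mul_of_neg_deriv_le_at_max (u := fun t ξ => -v t ξ) (g := 0) (K := 0)
    (fun t ht ξ => (hv' t ht ξ).neg)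
    (fun t ht ξ h => by
      rw [Pi.neg_apply, neg_neg, neg_nonpos]
      exact G.hjbField_nonneg_of_min (hmem t ht _) fun η => clip_mono (neg_le_neg_iff.1 (h η)))
    (fun ξ => by simpa [hvT] using G.terminal_nonneg ξ)
  have hbd : ∀ t ∈ Icc 0 G.T, ∀ ξ, v t ξ ∈ Icc 0 G.valueBound := fun t ht ξ => by
    refine ⟨by simpa using hge t ht ξ, (hle t ht ξ).trans ?_⟩
    have : 0 ≤ ∑ ξ, G.cost ξ 0 := Finset.sum_nonneg fun ξ _ => G.cost_nonneg ξ 0 zero_mem_orthant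
    unfold valueBound
    gcongr
    linarith [ht.1]
  refine ⟨v, G.isHJBSolution_iff.2 ⟨fun t ht => ?_, hvT⟩, hbd⟩
  have h := hv t ht
  rwa [clip_eq_self (hbd t ht)] at h

theorem Admissible.continuousOn {G : Game m N} {α : Control m N} (h : G.Admissible α) :
    ContinuousOn α (Icc 0 G.T) :=
  continuousOn_pi.2 fun ξ => (h.2.choose_spec ξ).continuousOn

theorem exists_isHJBSolution {β : Control m N} (hβ : G.Admissible β) :
    ∃ v, G.IsHJBSolution β v ∧ ∀ t ∈ Icc 0 G.T, ∀ ξ, v t ξ ∈ Icc 0 G.valueBound :=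
  G.exists_bounded_solution (B := Prod.fst) LipschitzWith.prod_fst.locallyLipschitz
    hβ.continuousOn fun t ht _ => hβ.1 t ht

theorem exists_isNLLSolution : ∃ v, G.IsNLLSolution v :=
  (G.exists_bounded_solution (B := fun x => G.feedbackMap x.2) (q := fun _ _ => 0)
    (G.locallyLipschitz_feedbackMap.comp LipschitzWith.prod_snd.locallyLipschitz)
    continuousOn_const fun _ _ φ => G.feedbackMap_mem φ).imp fun _ h => h.1

theorem IsHJBSolution.continuousOn {G : Game m N} {β : Control m N} {v : ℝ → State m N → ℝ}
    (h : G.IsHJBSolution β v) : ContinuousOn v (Icc 0 G.T) :=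
  continuousOn_of_hasDerivWithinAt (G.isHJBSolution_iff.1 h).1

theorem continuousOn_feedback {v : ℝ → State m N → ℝ} (hv : ContinuousOn v (Icc 0 G.T)) :
    ContinuousOn (G.feedback v) (Icc 0 G.T) :=
  G.locallyLipschitz_feedbackMap.continuous.comp_continuousOn hv

theorem continuousOn_hjbField {β : Control m N} {v : ℝ → State m N → ℝ} {s : Set ℝ}
    (hβ : ContinuousOn β s) (hv : ContinuousOn v s) :
    ContinuousOn (fun t => G.hjbField (β t) (v t)) s :=
  Continuous.comp_continuousOn
    (g := fun q : (State m N → RateVec m) × (State m N → ℝ) => G.hjbField q.1 q.2)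
    (f := fun t => (β t, v t)) G.locallyLipschitz_hjbField.continuous (hβ.prodMk hv)

/-- The time derivative is continuous, hence bounded, on the compact interval; so `v` is Lipschitz,
and the feedback map is Lipschitz on its compact range. -/
theorem IsHJBSolution.admissible_feedback {G : Game m N} {β : Control m N}
    {v : ℝ → State m N → ℝ} (h : G.IsHJBSolution β v) (hβ : ContinuousOn β (Icc 0 G.T)) :
    G.Admissible (G.feedback v) := by
  refine ⟨fun t _ ξ => G.argmin_mem _ _, ?_⟩
  have h' := (G.isHJBSolution_iff.1 h).1
  obtain ⟨L, hL⟩ := isCompact_Icc.exists_bound_of_continuousOn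
    (G.continuousOn_hjbField hβ h.continuousOn)
  have hvL : LipschitzOnWith L.toNNReal v (Icc 0 G.T) :=
    (convex_Icc _ _).lipschitzOnWith_of_nnnorm_hasDerivWithin_le h' fun t ht => by
      rw [nnnorm_neg]
      exact NNReal.coe_le_coe.1 ((hL t ht).trans (Real.le_coe_toNNReal L))
  obtain ⟨K, hK⟩ := (G.locallyLipschitz_feedbackMap.locallyLipschitzOn
    (s := _)).exists_lipschitzOnWith_of_compact
    (isCompact_Icc.image_of_continuousOn h.continuousOn)
  have hf := hK.comp hvL (mapsTo_image _ _)
  exact ⟨_, fun ξ x hx y hy => (edist_le_pi_edist (G.feedback v x) (G.feedback v y) ξ).trans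
    (hf hx hy)⟩

theorem IsNLLSolution.admissible_feedback {G : Game m N} {v : ℝ → State m N → ℝ}
    (h : G.IsNLLSolution v) : G.Admissible (G.feedback v) :=
  IsHJBSolution.admissible_feedback h (G.continuousOn_feedback (IsHJBSolution.continuousOn h))

theorem IsHJBSolution.congr_control {G : Game m N} {β β' : Control m N} {v : ℝ → State m N → ℝ}
    (h : G.IsHJBSolution β v) (hβ : ∀ t ∈ Icc 0 G.T, β t = β' t) : G.IsHJBSolution β' v :=
  ⟨fun t ht ξ => hβ t ht ▸ h.1 t ht ξ, h.2⟩

theorem IsHJBSolution.congr {G : Game m N} {β : Control m N} {v w : ℝ → State m N → ℝ}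
    (h : G.IsHJBSolution β v) (hw : ∀ t ∈ Icc 0 G.T, w t = v t) : G.IsHJBSolution β w := by
  refine ⟨fun t ht ξ => ?_, fun ξ => by rw [hw _ (right_mem_Icc.2 G.T_pos.le), h.2]⟩
  rw [hw t ht]
  exact (h.1 t ht ξ).congr (fun s hs => by rw [hw s hs]) (by rw [hw t ht])

end Game
end SymGame

/-! ### Kolmogorov's forward equation and the verification theorem -/

theorem nonneg_of_deriv_nonneg_of_neg {f f' : ℝ → ℝ} {a b : ℝ}
    (hf : ∀ t ∈ Icc a b, HasDerivWithinAt f (f' t) (Icc a b) t) (ha : 0 ≤ f a)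
    (h : ∀ t ∈ Icc a b, f t < 0 → 0 ≤ f' t) : ∀ t ∈ Icc a b, 0 ≤ f t := by
  intro t ht
  refine le_of_forall_pos_le_add fun ε hε => ?_
  have hba : 0 ≤ b - a := sub_nonneg.2 (ht.1.trans ht.2)
  set c := ε / (1 + (b - a)) with hc
  have hcpos : 0 < c := by positivity
  have key := image_le_of_deriv_right_lt_deriv_boundary (f := fun s => -f s)
    (f' := fun s => -f' s) (a := a) (b := b) (B := fun s => c * (1 + (s - a))) (B' := fun _ => c)
    (fun s hs => (hf s hs).neg.continuousWithinAt)
    (fun s hs => (hf s (Ico_subset_Icc_self hs)).neg.mono_of_mem_nhdsWithin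
      (Icc_mem_nhdsGE_of_mem hs))
    (by simp only [sub_self, add_zero, mul_one]; linarith)
    (fun s => by simpa using (((hasDerivAt_id s).sub_const a).const_add 1).const_mul c)
    (fun s hs hs' => by
      have : 0 < c * (1 + (s - a)) := mul_pos hcpos (by linarith [hs.1])
      have := h s (Ico_subset_Icc_self hs) (by linarith)
      linarith)
  have h1 := key ht
  have h2 : c * (1 + (t - a)) ≤ ε := by
    calc c * (1 + (t - a)) ≤ c * (1 + (b - a)) := by gcongr; exact ht.2
      _ = ε := div_mul_cancel₀ _ (by positivity)
  linarith

namespace SymGame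

variable {m N : ℕ}

namespace Game

variable (G : Game m N)

/-- The generator `L^a_x + L^b_μ` of the pair (position, empirical distribution). -/
def gen (a b : State m N → RateVec m) (φ : State m N → ℝ) (ξ : State m N) : ℝ :=
  G.genX a φ ξ + G.genMu b φ ξ

theorem gen_eq_sum_single (a b : State m N → RateVec m) (φ : State m N → ℝ) (ξ : State m N) :
    G.gen a b φ ξ = ∑ ζ, φ ζ * G.gen a b (Pi.single ζ 1) ξ := by
  have e : φ = fun η => ∑ ζ, φ ζ * (Pi.single ζ 1 : State m N → ℝ) η := by
    ext η
    simp [Pi.single_apply]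
  conv_lhs => rw [e]
  simp only [gen, genX_sum, genMu_sum, mul_add, Finset.sum_add_distrib]

theorem gen_const (a b : State m N → RateVec m) (c : ℝ) (ξ : State m N) :
    G.gen a b (fun _ => c) ξ = 0 := by
  simp [gen, genX, genMu]

theorem gen_nonneg_of_min {a b : State m N → RateVec m} (ha : ∀ ξ, a ξ ∈ orthant m)
    (hb : ∀ ξ, b ξ ∈ orthant m) {φ : State m N → ℝ} {ξ : State m N} (h : ∀ η, φ ξ ≤ φ η) :
    0 ≤ G.gen a b φ ξ := by
  have h1 := G.genX_nonpos_of_max ha (φ := fun η => -φ η) fun η => neg_le_neg (h η)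
  have h2 := G.genMu_nonpos_of_max hb (φ := fun η => -φ η) fun η => neg_le_neg (h η)
  rw [genX_neg] at h1
  rw [genMu_neg] at h2
  unfold gen
  linarith

/-- The right side of Kolmogorov's forward equation. -/
def forwardField (a b : State m N → RateVec m) (p : State m N → ℝ) (ζ : State m N) : ℝ :=
  ∑ η, p η * G.gen a b (Pi.single ζ 1) η

/-- The forward field is the transpose of the generator; testing on indicators suffices by
linearity. -/
theorem sum_forwardField_mul (a b : State m N → RateVec m) (p φ : State m N → ℝ) :
    ∑ ζ, G.forwardField a b p ζ * φ ζ = ∑ η, p η * G.gen a b φ η := by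
  simp only [forwardField, Finset.sum_mul]
  rw [Finset.sum_comm]
  refine Finset.sum_congr rfl fun η _ => ?_
  rw [gen_eq_sum_single, Finset.mul_sum]
  exact Finset.sum_congr rfl fun ζ _ => by ring

theorem locallyLipschitz_forwardField : LocallyLipschitz
    fun q : ((State m N → RateVec m) × (State m N → RateVec m)) × (State m N → ℝ) =>
      G.forwardField q.1.1 q.1.2 q.2 := by
  have hgen : ∀ ζ η, ContDiff ℝ 1
      fun q : ((State m N → RateVec m) × (State m N → RateVec m)) × (State m N → ℝ) =>
        G.gen q.1.1 q.1.2 (Pi.single ζ 1) η := by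
    intro ζ η
    have hX := (G.contDiff_genX η).comp
      (f := fun q : ((State m N → RateVec m) × (State m N → RateVec m)) × (State m N → ℝ) =>
        (q.1.1, (Pi.single ζ 1 : State m N → ℝ))) (contDiff_fst.fst.prodMk contDiff_const)
    have hMu := (G.contDiff_genMu η).comp
      (f := fun q : ((State m N → RateVec m) × (State m N → RateVec m)) × (State m N → ℝ) =>
        (q.1.2, (Pi.single ζ 1 : State m N → ℝ))) (contDiff_fst.snd.prodMk contDiff_const)
    exact hX.add hMu
  refine locallyLipschitz_pi fun ζ => ContDiff.locallyLipschitz (𝕂 := ℝ) ?_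
  exact ContDiff.sum fun η _ => ContDiff.mul (by fun_prop) (hgen ζ η)

/-- The equation is solved with `p` truncated to `[0, 1]`; the solution stays in the simplex, so the
truncation drops out. -/
theorem exists_isLaw {α β : Control m N} (hα : G.Admissible α) (hβ : G.Admissible β) {t : ℝ}
    (ht : t ∈ Icc 0 G.T) (ξ : State m N) : ∃ p, G.IsLaw α β t ξ p := by
  have hsub : Icc t G.T ⊆ Icc 0 G.T := Icc_subset_Icc_left ht.1
  obtain ⟨p, hp0, hp⟩ := exists_hasDerivWithinAt_of_locallyLipschitz
    G.locallyLipschitz_forwardField (lipschitzWith_clip 1) (isBounded_range_clip zero_le_one)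
    (left_mem_Icc.2 ht.2) ((hα.continuousOn.prodMk hβ.continuousOn).mono hsub)
    (Pi.single ξ 1)
  have hp' : ∀ u ∈ Icc t G.T, ∀ φ : State m N → ℝ, HasDerivWithinAt (fun s => ∑ η, p s η * φ η)
      (∑ η, clip 1 (p u) η * G.gen (α u) (β u) φ η) (Icc t G.T) u := by
    intro u hu φ
    rw [← sum_forwardField_mul]
    exact HasDerivWithinAt.fun_sum fun η _ => (hasDerivWithinAt_pi.1 (hp u hu) η).mul_const (φ η)
  have hnonneg : ∀ u ∈ Icc t G.T, ∀ ζ, 0 ≤ p u ζ := by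
    intro u hu ζ
    refine nonneg_of_deriv_nonneg_of_neg (fun s hs => hasDerivWithinAt_pi.1 (hp s hs) ζ) ?_ ?_ u hu
    · rw [hp0, Pi.single_apply]
      split_ifs <;> simp
    · intro s hs hneg
      refine Finset.sum_nonneg fun η _ => ?_
      -- Outflow from `ζ` vanishes since its truncated mass is `0`; inflow from other states is
      -- nonnegative.
      by_cases h : η = ζ
      · have : clip 1 (p s) η = 0 := max_eq_left ((min_le_left _ _).trans (h ▸ hneg.le))
        simp [this]
      · refine mul_nonneg (le_max_left _ _) (G.gen_nonneg_of_min (hα.1 s (hsub hs))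
          (hβ.1 s (hsub hs)) fun η' => ?_)
        rw [Pi.single_apply, Pi.single_apply, if_neg h]
        split_ifs <;> simp
  have hsum : ∀ u ∈ Icc t G.T, ∑ ζ, p u ζ = 1 := by
    intro u hu
    have h := constant_of_has_deriv_right_zero (f := fun s => ∑ η, p s η * 1) (a := t) (b := G.T)
      (fun s hs => (hp' s hs fun _ => 1).continuousWithinAt)
      (fun s hs => by
        have := (hp' s (Ico_subset_Icc_self hs) fun _ => 1).mono_of_mem_nhdsWithin
          (Icc_mem_nhdsGE_of_mem hs)
        simpa only [gen_const, mul_zero, Finset.sum_const_zero] using this) u hu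
    simpa [hp0] using h
  have hmem : ∀ u ∈ Icc t G.T, p u ∈ stdSimplex ℝ (State m N) :=
    fun u hu => ⟨hnonneg u hu, hsum u hu⟩
  refine ⟨p, hp0, hmem, fun φ u hu => ?_⟩
  have h := hp' u hu φ
  rwa [clip_eq_self fun ζ => mem_Icc_of_mem_stdSimplex (hmem u hu) ζ] at h

theorem isLaw_law {α β : Control m N} (hα : G.Admissible α) (hβ : G.Admissible β) {t : ℝ}
    (ht : t ∈ Icc 0 G.T) (ξ : State m N) : G.IsLaw α β t ξ (G.law α β t ξ) :=
  Classical.epsilon_spec (G.exists_isLaw hα hβ ht ξ)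

theorem IsLaw.hasDerivWithinAt {G : Game m N} {α β : Control m N} {t : ℝ} {ξ : State m N}
    {p : ℝ → State m N → ℝ} (h : G.IsLaw α β t ξ p) {u : ℝ} (hu : u ∈ Icc t G.T) :
    HasDerivWithinAt p (G.forwardField (α u) (β u) (p u)) (Icc t G.T) u :=
  hasDerivWithinAt_pi.2 fun ζ => by
    have e : (fun s => p s ζ) = fun s => ∑ η, p s η * (Pi.single ζ 1 : State m N → ℝ) η := by
      ext s
      simp [Pi.single_apply]
    rw [e]
    exact h.2.2 (Pi.single ζ 1) u hu

theorem continuousOn_cost {α : Control m N} (hα : G.Admissible α) (η : State m N) :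
    ContinuousOn (fun u => G.cost η (α u η)) (Icc 0 G.T) :=
  (G.cost_continuous η).comp (continuousOn_pi.1 hα.continuousOn η) fun u hu => hα.1 u hu η

/-- The suboptimality of the action `a` in the state `ξ` with respect to `φ`. -/
def gap (a : State m N → RateVec m) (φ : State m N → ℝ) (ξ : State m N) : ℝ :=
  G.cost ξ (a ξ) + G.genX a φ ξ - G.H ξ (diffVec φ ξ)

theorem gap_nonneg {a : State m N → RateVec m} (ha : ∀ ξ, a ξ ∈ orthant m) (φ : State m N → ℝ)
    (ξ : State m N) : 0 ≤ G.gap a φ ξ :=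
  sub_nonneg.2 (G.H_le ξ (diffVec φ ξ) (ha ξ))

theorem gap_feedbackMap (φ : State m N → ℝ) (ξ : State m N) :
    G.gap (G.feedbackMap φ) φ ξ = 0 :=
  sub_eq_zero.2 (G.H_eq ξ (diffVec φ ξ)).symm

theorem continuousOn_gap {α : Control m N} (hα : G.Admissible α) {v : ℝ → State m N → ℝ}
    (hv : ContinuousOn v (Icc 0 G.T)) (η : State m N) :
    ContinuousOn (fun u => G.gap (α u) (v u) η) (Icc 0 G.T) := by
  have h1 : ContinuousOn (fun u => G.genX (α u) (v u) η) (Icc 0 G.T) :=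
    Continuous.comp_continuousOn
      (g := fun q : (State m N → RateVec m) × (State m N → ℝ) => G.genX q.1 q.2 η)
      (f := fun u => (α u, v u)) (G.contDiff_genX η).continuous (hα.continuousOn.prodMk hv)
  have h2 : ContinuousOn (fun u => G.H η (diffVec (v u) η)) (Icc 0 G.T) :=
    (G.locallyLipschitz_H η).continuous.comp_continuousOn
      ((contDiff_diffVec η).continuous.comp_continuousOn hv)
  exact ((G.continuousOn_cost hα η).add h1).sub h2

/-- Dynkin's formula, applied to a solution of the dynamic programming equation. -/
theorem J_eq_add_integral_gap {α β : Control m N} (hα : G.Admissible α) (hβ : G.Admissible β)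
    {w : ℝ → State m N → ℝ} (hw : G.IsHJBSolution β w) {t : ℝ} (ht : t ∈ Icc 0 G.T)
    (ξ : State m N) :
    G.J t ξ α β = w t ξ + ∫ u in t..G.T, ∑ η, G.law α β t ξ u η * G.gap (α u) (w u) η := by
  have hsub : Icc t G.T ⊆ Icc 0 G.T := Icc_subset_Icc_left ht.1
  have hlaw := G.isLaw_law hα hβ ht ξ
  set p := G.law α β t ξ
  have hpc : ∀ η, ContinuousOn (fun u => p u η) (Icc t G.T) := fun η u hu =>
    (hasDerivWithinAt_pi.1 (hlaw.hasDerivWithinAt hu) η).continuousWithinAt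
  have hcost : ContinuousOn (fun u => ∑ η, p u η * G.cost η (α u η)) (Icc t G.T) :=
    continuousOn_finsetSum _ fun η _ => (hpc η).mul ((G.continuousOn_cost hα η).mono hsub)
  have hgap : ContinuousOn (fun u => ∑ η, p u η * G.gap (α u) (w u) η) (Icc t G.T) :=
    continuousOn_finsetSum _ fun η _ =>
      (hpc η).mul ((G.continuousOn_gap hα hw.continuousOn η).mono hsub)
  -- The `L^β_μ w` from the forward equation cancels against the one in HJB; `L^α_x w - H`, which
  -- remains, is `gap` minus running cost.
  have hderiv : ∀ u ∈ Icc t G.T, HasDerivWithinAt (fun s => ∑ η, p s η * w s η)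
      (∑ η, p u η * G.gap (α u) (w u) η - ∑ η, p u η * G.cost η (α u η)) (Icc t G.T) u := by
    intro u hu
    have h : HasDerivWithinAt (fun s => ∑ η, p s η * w s η) _ (Icc t G.T) u :=
      HasDerivWithinAt.fun_sum (u := Finset.univ) fun η _ =>
        (hasDerivWithinAt_pi.1 (hlaw.hasDerivWithinAt hu) η).mul ((hw.1 u (hsub hu) η).mono hsub)
    refine h.congr_deriv ?_
    rw [Finset.sum_add_distrib, sum_forwardField_mul, ← Finset.sum_add_distrib,
      ← Finset.sum_sub_distrib]
    refine Finset.sum_congr rfl fun η _ => ?_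
    simp only [gen, gap]
    ring
  have hi1 := hgap.intervalIntegrable_of_Icc ht.2 (μ := MeasureTheory.volume)
  have hi2 := hcost.intervalIntegrable_of_Icc ht.2 (μ := MeasureTheory.volume)
  have hFTC := intervalIntegral.integral_eq_sub_of_hasDerivAt_of_le ht.2
    (fun u hu => (hderiv u hu).continuousWithinAt)
    (fun u hu => (hderiv u (Ioo_subset_Icc_self hu)).hasDerivAt (Icc_mem_nhds hu.1 hu.2))
    (hi1.sub hi2)
  rw [intervalIntegral.integral_sub hi1 hi2] at hFTC
  have h0 : ∑ η, p t η * w t η = w t ξ := by simp [hlaw.1, Pi.single_apply]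
  have hT : ∑ η, p G.T η * w G.T η = ∑ η, p G.T η * G.terminal η := by simp only [hw.2]
  rw [h0, hT] at hFTC
  change (∫ u in t..G.T, ∑ η, p u η * G.cost η (α u η)) + ∑ η, p G.T η * G.terminal η = _
  linarith

theorem value_eq {β : Control m N} (hβ : G.Admissible β) {w : ℝ → State m N → ℝ}
    (hw : G.IsHJBSolution β w) {t : ℝ} (ht : t ∈ Icc 0 G.T) : G.value β t = w t := by
  ext ξ
  have hsub : Icc t G.T ⊆ Icc 0 G.T := Icc_subset_Icc_left ht.1
  have hlow : ∀ α : {α : Control m N // G.Admissible α}, w t ξ ≤ G.J t ξ α.1 β := by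
    intro α
    rw [G.J_eq_add_integral_gap α.2 hβ hw ht, le_add_iff_nonneg_right]
    exact intervalIntegral.integral_nonneg ht.2 fun u hu => Finset.sum_nonneg fun η _ =>
      mul_nonneg (((G.isLaw_law α.2 hβ ht ξ).2.1 u hu).1 η)
        (G.gap_nonneg (α.2.1 u (hsub hu)) _ _)
  have hf : G.Admissible (G.feedback w) := hw.admissible_feedback hβ.continuousOn
  have hopt : G.J t ξ (G.feedback w) β = w t ξ := by
    rw [G.J_eq_add_integral_gap hf hβ hw ht, add_eq_left]
    have : ∀ u η, G.gap (G.feedback w u) (w u) η = 0 := fun u η => G.gap_feedbackMap (w u) η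
    simp [this]
  have : Nonempty {α : Control m N // G.Admissible α} := ⟨⟨_, hf⟩⟩
  refine le_antisymm ?_ (le_ciInf hlow)
  rw [← hopt]
  exact ciInf_le ⟨w t ξ, by rintro _ ⟨α, rfl⟩; exact hlow α⟩
    (⟨_, hf⟩ : {α : Control m N // G.Admissible α})

theorem isHJBSolution_value {β : Control m N} (hβ : G.Admissible β) :
    G.IsHJBSolution β (G.value β) := by
  obtain ⟨w, hw, -⟩ := G.exists_isHJBSolution hβ
  exact hw.congr fun t ht => G.value_eq hβ hw ht

theorem value_mem_Icc {β : Control m N} (hβ : G.Admissible β) {t : ℝ} (ht : t ∈ Icc 0 G.T)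
    (ξ : State m N) : G.value β t ξ ∈ Icc 0 G.valueBound := by
  obtain ⟨w, hw, hb⟩ := G.exists_isHJBSolution hβ
  rw [G.value_eq hβ hw ht]
  exact hb t ht ξ

theorem admissible_bestResponse {β : Control m N} (hβ : G.Admissible β) :
    G.Admissible (G.bestResponse β) :=
  (G.isHJBSolution_value hβ).admissible_feedback hβ.continuousOn

end Game
end SymGame

/-! ### Uniqueness, equilibria and convergence of the iteration -/

theorem tendstoUniformlyOn_of_dist_le_mul_pow {α β : Type*} [PseudoMetricSpace β] {F : ℕ → α → β}
    {f : α → β} {s : Set α} {B q : ℝ} (hq0 : 0 ≤ q) (hq1 : q < 1)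
    (h : ∀ n, ∀ x ∈ s, dist (F n x) (f x) ≤ B * q ^ n) : TendstoUniformlyOn F f atTop s := by
  rw [Metric.tendstoUniformlyOn_iff]
  intro ε hε
  have hlim : Tendsto (fun n : ℕ => B * q ^ n) atTop (𝓝 0) := by
    simpa using (tendsto_pow_atTop_nhds_zero_of_lt_one hq0 hq1).const_mul B
  filter_upwards [hlim.eventually (gt_mem_nhds hε)] with n hn x hx
  rw [dist_comm]
  exact (h n x hx).trans_lt hn

namespace SymGame

variable {m N : ℕ}

namespace Game

variable (G : Game m N)

theorem IsNLLSolution.value_feedback {G : Game m N} {v : ℝ → State m N → ℝ}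
    (h : G.IsNLLSolution v) {t : ℝ} (ht : t ∈ Icc 0 G.T) : G.value (G.feedback v) t = v t :=
  G.value_eq h.admissible_feedback h ht

theorem IsNLLSolution.mem_Icc {G : Game m N} {v : ℝ → State m N → ℝ}
    (h : G.IsNLLSolution v) {t : ℝ} (ht : t ∈ Icc 0 G.T) :
    v t ∈ Icc (0 : State m N → ℝ) fun _ => G.valueBound := by
  rw [← h.value_feedback ht]
  exact ⟨fun ξ => (G.value_mem_Icc h.admissible_feedback ht ξ).1,
    fun ξ => (G.value_mem_Icc h.admissible_feedback ht ξ).2⟩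

theorem IsNLLSolution.eqOn {G : Game m N} {v w : ℝ → State m N → ℝ}
    (hv : G.IsNLLSolution v) (hw : G.IsNLLSolution w) : ∀ t ∈ Icc 0 G.T, w t = v t := by
  have hF : LocallyLipschitz fun φ : State m N → ℝ => G.hjbField (G.feedbackMap φ) φ :=
    LocallyLipschitz.comp
      (f := fun q : (State m N → RateVec m) × (State m N → ℝ) => G.hjbField q.1 q.2)
      (g := fun φ => (G.feedbackMap φ, φ)) G.locallyLipschitz_hjbField (G.locallyLipschitz_feedbackMap.prodMk LocallyLipschitz.id)
  obtain ⟨K, hK⟩ := (hF.locallyLipschitzOn (s := _)).exists_lipschitzOnWith_of_compact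
    (isCompact_Icc (a := (0 : State m N → ℝ)) (b := fun _ => G.valueBound))
  obtain ⟨hv', hvT⟩ := G.isHJBSolution_iff.1 hv
  obtain ⟨hw', hwT⟩ := G.isHJBSolution_iff.1 hw
  intro t ht
  refine sub_eq_zero.1 (eqOn_zero_of_norm_deriv_le (u := fun t => w t - v t) K.2
    (fun s hs => (hw' s hs).sub (hv' s hs)) (by simp [hvT, hwT]) (fun s hs => ?_) t ht)
  rw [neg_sub_neg, ← dist_eq_norm, ← dist_eq_norm, dist_comm (w s)]
  exact hK.dist_le_mul _ (hv.mem_Icc hs) _ (hw.mem_Icc hs)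

theorem IsNLLSolution.isMPE {G : Game m N} {v : ℝ → State m N → ℝ} (h : G.IsNLLSolution v) :
    G.IsMPE (G.feedback v) := by
  refine ⟨h.admissible_feedback, fun t ht => ?_⟩
  change G.feedbackMap (v t) = G.feedbackMap (G.value (G.feedback v) t)
  rw [h.value_feedback ht]

/-- An equilibrium is the feedback of its own value function, so HJB against it is NLL. -/
theorem IsMPE.isNLLSolution_value {G : Game m N} {α : Control m N} (h : G.IsMPE α) :
    G.IsNLLSolution (G.value α) :=
  (G.isHJBSolution_value h.1).congr_control h.2

theorem Admissible.convexComb {G : Game m N} {α β : Control m N} (hα : G.Admissible α)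
    (hβ : G.Admissible β) {ρ : ℝ} (h0 : 0 ≤ ρ) (h1 : ρ ≤ 1) :
    G.Admissible fun t ξ => ρ • α t ξ + (1 - ρ) • β t ξ := by
  obtain ⟨K, hK⟩ := hα.2
  obtain ⟨L, hL⟩ := hβ.2
  refine ⟨fun t ht ξ => convex_orthant (hα.1 t ht ξ) (hβ.1 t ht ξ) h0 (sub_nonneg.2 h1) (by ring),
    ⟨‖ρ‖₊ * K + ‖1 - ρ‖₊ * L, fun ξ => ?_⟩⟩
  exact ((lipschitzWith_smul ρ).comp_lipschitzOnWith (hK ξ)).add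
    ((lipschitzWith_smul (1 - ρ)).comp_lipschitzOnWith (hL ξ))

theorem admissible_iterBeta {ρ : ℝ} (h0 : 0 ≤ ρ) (h1 : ρ < 1) {β₀ : Control m N}
    (hβ : G.Admissible β₀) (n : ℕ) : G.Admissible (G.iterBeta ρ β₀ n) := by
  induction n with
  | zero => exact hβ
  | succ n ih => exact ih.convexComb (G.admissible_bestResponse ih) h0 h1.le

/-- All value functions lie in one compact box, whatever `β` is; hence one bound serves all
iterates. -/
theorem exists_norm_bestResponse_le : ∃ M : ℝ, ∀ β, G.Admissible β → ∀ t ∈ Icc 0 G.T,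
    ‖G.bestResponse β t‖ ≤ M := by
  obtain ⟨M, hM⟩ := (isCompact_Icc (a := (0 : State m N → ℝ)) (b := fun _ => G.valueBound)
    ).exists_bound_of_continuousOn G.locallyLipschitz_feedbackMap.continuous.continuousOn
  exact ⟨M, fun β hβ t ht => hM _ ⟨fun ξ => (G.value_mem_Icc hβ ht ξ).1,
    fun ξ => (G.value_mem_Icc hβ ht ξ).2⟩⟩

theorem norm_convexComb_le {E : Type*} [NormedAddCommGroup E] [NormedSpace ℝ E] {x y : E}
    {ρ a b : ℝ} (h0 : 0 ≤ ρ) (h1 : ρ ≤ 1) (hx : ‖x‖ ≤ a) (hy : ‖y‖ ≤ b) :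
    ‖ρ • x + (1 - ρ) • y‖ ≤ ρ * a + (1 - ρ) * b := by
  have h1' : 0 ≤ 1 - ρ := sub_nonneg.2 h1
  refine (norm_add_le _ _).trans ?_
  rw [norm_smul, norm_smul, Real.norm_of_nonneg h0, Real.norm_of_nonneg h1']
  gcongr

theorem iterBeta_succ (ρ : ℝ) (β₀ : Control m N) (n : ℕ) (t : ℝ) :
    G.iterBeta ρ β₀ (n + 1) t =
      ρ • G.iterBeta ρ β₀ n t + (1 - ρ) • G.bestResponse (G.iterBeta ρ β₀ n) t := rfl

theorem norm_iterBeta_le {ρ : ℝ} (h0 : 0 ≤ ρ) (h1 : ρ < 1) {β₀ : Control m N}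
    (hβ : G.Admissible β₀) {M : ℝ} (hM₀ : ∀ t ∈ Icc 0 G.T, ‖β₀ t‖ ≤ M)
    (hM : ∀ β, G.Admissible β → ∀ t ∈ Icc 0 G.T, ‖G.bestResponse β t‖ ≤ M) (n : ℕ) :
    ∀ t ∈ Icc 0 G.T, ‖G.iterBeta ρ β₀ n t‖ ≤ M := by
  induction n with
  | zero => exact hM₀
  | succ n ih =>
    intro t ht
    rw [iterBeta_succ]
    refine (norm_convexComb_le h0 h1.le (ih t ht)
      (hM _ (G.admissible_iterBeta h0 h1 hβ n) t ht)).trans_eq ?_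
    ring

/-- The best response map contracts, in a suitable exponentially weighted uniform norm, the distance
to the equilibrium, among the controls bounded by a given constant. -/
theorem exists_contraction {v : ℝ → State m N → ℝ} (hv : G.IsNLLSolution v) (M : ℝ) :
    ∃ θ δ : ℝ, 0 < θ ∧ 0 < δ ∧ ∀ β, G.Admissible β → (∀ t ∈ Icc 0 G.T, ‖β t‖ ≤ M) →
      ∀ A : ℝ, 0 < A →
      (∀ t ∈ Icc 0 G.T, ‖β t - G.feedback v t‖ ≤ A * Real.exp (θ * (G.T - t))) →
      ∀ t ∈ Icc 0 G.T, ‖G.value β t - v t‖ ≤ δ * (A * Real.exp (θ * (G.T - t))) ∧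
        ‖G.bestResponse β t - G.feedback v t‖ ≤ 1 / 2 * (A * Real.exp (θ * (G.T - t))) := by
  have hcv : IsCompact (Icc (0 : State m N → ℝ) fun _ => G.valueBound) := isCompact_Icc
  obtain ⟨M', hM'⟩ := isCompact_Icc.exists_bound_of_continuousOn
    (G.continuousOn_feedback (IsHJBSolution.continuousOn hv))
  obtain ⟨K, hK⟩ := (G.locallyLipschitz_hjbField.locallyLipschitzOn
    (s := _)).exists_lipschitzOnWith_of_compact
    ((isCompact_closedBall (0 : State m N → RateVec m) (max M M')).prod hcv)
  obtain ⟨L, hL⟩ := (G.locallyLipschitz_feedbackMap.locallyLipschitzOn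
    (s := _)).exists_lipschitzOnWith_of_compact hcv
  -- `δ` is chosen so that the Lipschitz feedback map turns an error `δ` in the value into at most
  -- `1 / 2` in the control.
  have hδ : (0 : ℝ) < 1 / (2 * (L + 1)) := by positivity
  have hδL : L * (1 / (2 * (L + 1) : ℝ)) ≤ 1 / 2 := by
    rw [mul_one_div, div_le_iff₀ (by positivity)]
    linarith
  generalize 1 / (2 * (L + 1) : ℝ) = δ at hδ hδL
  -- The added `1` makes the barrier condition `K (δ + 1) < θ δ` strict.
  refine ⟨K * (δ + 1) / δ + 1, δ, by positivity, hδ, fun β hβ hβM A hA hβv => ?_⟩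
  have hθ : K * (δ + 1) < (K * (δ + 1) / δ + 1) * δ := by
    rw [add_mul, div_mul_cancel₀ _ hδ.ne']
    linarith
  generalize K * (δ + 1) / δ + 1 = θ at hθ hβv
  have hmem : ∀ t ∈ Icc 0 G.T, G.value β t ∈ Icc (0 : State m N → ℝ) fun _ => G.valueBound :=
    fun t ht => ⟨fun ξ => (G.value_mem_Icc hβ ht ξ).1, fun ξ => (G.value_mem_Icc hβ ht ξ).2⟩
  obtain ⟨hv', hvT⟩ := G.isHJBSolution_iff.1 hv
  obtain ⟨hw', hwT⟩ := G.isHJBSolution_iff.1 (G.isHJBSolution_value hβ)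
  have key := norm_le_exp_of_norm_deriv_le (u := fun t => G.value β t - v t)
    (fun s hs => (hw' s hs).sub (hv' s hs)) (by simp [hvT, hwT]) hA hδ hθ (fun s hs => by
      have h := hK.dist_le_mul (β s, G.value β s)
        ⟨mem_closedBall_zero_iff.2 ((hβM s hs).trans (le_max_left _ _)), hmem s hs⟩
        (G.feedback v s, v s)
        ⟨mem_closedBall_zero_iff.2 ((hM' s hs).trans (le_max_right _ _)), hv.mem_Icc hs⟩
      rw [neg_sub_neg, ← dist_eq_norm, dist_comm]
      refine h.trans ?_
      rw [Prod.dist_eq, dist_eq_norm, dist_eq_norm]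
      gcongr
      refine max_le ((hβv s hs).trans ?_) ?_
      · exact le_add_of_nonneg_left (norm_nonneg _)
      · exact le_add_of_nonneg_right (by positivity))
  refine fun t ht => ⟨key t ht, ?_⟩
  have h := hL.dist_le_mul _ (hmem t ht) _ (hv.mem_Icc ht)
  rw [dist_eq_norm, dist_eq_norm] at h
  refine h.trans ((mul_le_mul_of_nonneg_left (key t ht) L.2).trans ?_)
  rw [← mul_assoc]
  gcongr
  exact hδL

theorem exists_iter_bounds {v : ℝ → State m N → ℝ} (hv : G.IsNLLSolution v) {ρ : ℝ} (h0 : 0 ≤ ρ)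
    (h1 : ρ < 1) {c : ℝ} {β₀ : Control m N} (hβ : G.AdmissibleBdd c β₀) :
    ∃ B q : ℝ, 0 ≤ q ∧ q < 1 ∧ ∀ n : ℕ, ∀ t ∈ Icc 0 G.T,
      ‖G.iterValue ρ β₀ n t - v t‖ ≤ B * q ^ n ∧
        ‖G.iterAlpha ρ β₀ n t - G.feedback v t‖ ≤ B * q ^ n := by
  obtain ⟨M₁, hM₁⟩ := G.exists_norm_bestResponse_le
  obtain ⟨M₂, hM₂⟩ := isCompact_Icc.exists_bound_of_continuousOn
    (G.continuousOn_feedback (IsHJBSolution.continuousOn hv))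
  set M := max |c| M₁
  have hM : 0 ≤ M := (abs_nonneg c).trans (le_max_left _ _)
  have hβM : ∀ t ∈ Icc 0 G.T, ‖β₀ t‖ ≤ M := fun t ht =>
    (pi_norm_le_iff_of_nonneg hM).2 fun ξ =>
      (hβ.2 t ht ξ).trans ((le_abs_self c).trans (le_max_left _ _))
  have hbd := G.norm_iterBeta_le h0 h1 hβ.1 hβM fun β hβ t ht =>
    (hM₁ β hβ t ht).trans (le_max_right _ _)
  have hadm := G.admissible_iterBeta h0 h1 hβ.1
  obtain ⟨θ, δ, hθ, hδ, hcontr⟩ := G.exists_contraction hv M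
  set A := M + |M₂| + 1
  have hA : 0 < A := by positivity
  -- The old control keeps its error with weight `ρ`; the best response halves it with weight `1 -
  -- ρ`.
  set q := ρ + (1 - ρ) / 2 with hq
  have hq0 : 0 < q := by rw [hq]; linarith
  have hq1 : q < 1 := by rw [hq]; linarith
  have hiter : ∀ n : ℕ, ∀ t ∈ Icc 0 G.T,
      ‖G.iterBeta ρ β₀ n t - G.feedback v t‖ ≤ A * q ^ n * Real.exp (θ * (G.T - t)) := by
    intro n
    induction n with
    | zero =>
      intro t ht
      have he : 1 ≤ Real.exp (θ * (G.T - t)) :=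
        Real.one_le_exp (mul_nonneg hθ.le (sub_nonneg.2 ht.2))
      rw [pow_zero, mul_one]
      refine (norm_sub_le _ _).trans (le_trans ?_ (le_mul_of_one_le_right hA.le he))
      have := hβM t ht
      have := (hM₂ t ht).trans (le_abs_self M₂)
      change ‖β₀ t‖ + _ ≤ M + |M₂| + 1
      linarith
    | succ n ih =>
      intro t ht
      have h := (hcontr _ (hadm n) (hbd n) (A * q ^ n) (by positivity) ih t ht).2
      have e : G.iterBeta ρ β₀ (n + 1) t - G.feedback v t =
          ρ • (G.iterBeta ρ β₀ n t - G.feedback v t) +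
            (1 - ρ) • (G.bestResponse (G.iterBeta ρ β₀ n) t - G.feedback v t) := by
        rw [iterBeta_succ]
        module
      rw [e]
      refine (norm_convexComb_le h0 h1.le (ih t ht) h).trans_eq ?_
      rw [hq]
      ring
  -- `δ + 1 / 2` dominates the factors of both estimates, and the weight is largest at time `0`.
  refine ⟨(δ + 1 / 2) * (A * Real.exp (θ * G.T)), q, hq0.le, hq1, fun n t ht => ?_⟩
  obtain ⟨h2, h3⟩ := hcontr _ (hadm n) (hbd n) (A * q ^ n) (by positivity) (hiter n) t ht
  have he : A * q ^ n * Real.exp (θ * (G.T - t)) ≤ A * q ^ n * Real.exp (θ * G.T) := by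
    gcongr
    linarith [ht.1]
  have e : (δ + 1 / 2) * (A * Real.exp (θ * G.T)) * q ^ n =
      (δ + 1 / 2) * (A * q ^ n * Real.exp (θ * G.T)) := by ring
  rw [e]
  constructor
  · refine h2.trans (mul_le_mul (by linarith) he (by positivity) (by positivity))
  · refine h3.trans (mul_le_mul (by linarith) he (by positivity) (by positivity))

end Game
end SymGame

end

theorem theorem3p2 (m N : ℕ) (hN : 0 < N) (G : SymGame.Game m N) :
    ∃ v : ℝ → SymGame.State m N → ℝ,
      -- `v` is the unique classical solution of the Nash-Lasry-Lions system on `[0,T]`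
      (G.IsNLLSolution v ∧
        ∀ w, G.IsNLLSolution w → ∀ t ∈ Set.Icc 0 G.T, w t = v t) ∧
      -- its feedback control is the unique Markov perfect equilibrium on `[0,T]`
      (G.IsMPE (G.feedback v) ∧
        ∀ α, G.IsMPE α → ∀ t ∈ Set.Icc 0 G.T, α t = G.feedback v t) ∧
      -- the (weighted) Picard iteration is well posed and converges
      ∀ (ρ : ℝ), 0 ≤ ρ → ρ < 1 →
        ∀ (c : ℝ) (β0 : SymGame.Control m N), G.AdmissibleBdd c β0 →
          (∀ n : ℕ, G.Admissible (G.iterBeta ρ β0 n) ∧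
            G.IsHJBSolution (G.iterBeta ρ β0 n) (G.iterValue ρ β0 n) ∧
            ∀ w, G.IsHJBSolution (G.iterBeta ρ β0 n) w →
              ∀ t ∈ Set.Icc 0 G.T, w t = G.iterValue ρ β0 n t) ∧
          TendstoUniformlyOn
            (fun (n : ℕ) (q : ℝ × SymGame.State m N) => G.iterValue ρ β0 n q.1 q.2)
            (fun q => v q.1 q.2) Filter.atTop (Set.Icc 0 G.T ×ˢ Set.univ) ∧
          TendstoUniformlyOn
            (fun (n : ℕ) (q : ℝ × SymGame.State m N) => G.iterAlpha ρ β0 n q.1 q.2)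
            (fun q => G.feedback v q.1 q.2) Filter.atTop (Set.Icc 0 G.T ×ˢ Set.univ) := by
  obtain ⟨v, hv⟩ := G.exists_isNLLSolution
  refine ⟨v, ⟨hv, fun w hw => hv.eqOn hw⟩, ⟨hv.isMPE, fun α hα t ht => ?_⟩,
    fun ρ h0 h1 c β0 hβ => ⟨fun n => ?_, ?_⟩⟩
  · rw [hα.2 t ht]
    change G.feedbackMap (G.value α t) = G.feedbackMap (v t)
    rw [hv.eqOn hα.isNLLSolution_value t ht]
  · have h := G.admissible_iterBeta h0 h1 hβ.1 n
    exact ⟨h, G.isHJBSolution_value h, fun w hw t ht => (G.value_eq h hw ht).symm⟩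
  · obtain ⟨B, q, hq0, hq1, hB⟩ := G.exists_iter_bounds hv h0 h1 hβ
    refine ⟨tendstoUniformlyOn_of_dist_le_mul_pow (B := B) hq0 hq1 fun n x hx => ?_,
      tendstoUniformlyOn_of_dist_le_mul_pow (B := B) hq0 hq1 fun n x hx => ?_⟩
    · refine (dist_le_pi_dist (G.iterValue ρ β0 n x.1) (v x.1) x.2).trans ?_
      rw [dist_eq_norm]
      exact (hB n x.1 hx.1).1
    · refine (dist_le_pi_dist (G.iterAlpha ρ β0 n x.1) (G.feedback v x.1) x.2).trans ?_
      rw [dist_eq_norm]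
      exact (hB n x.1 hx.1).2
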